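/- A \emph{mixture} is a function $\xi(x)=\sum_{p\ge2}c_p^2x^p$ with $c_p\ge0$, $\sum_p c_p^2=1$ and $\sum_p2^pc_p<\infty$. Let $\mathcal K$ be the set of measures $\nu(ds)=\mathbf 1_{[0,1)}(s)\gamma(s)\,ds+\Delta\,\delta_1(ds)$ on $[0,1]$ with $\gamma\ge0$ nondecreasing and right-continuous on $[0,1)$ and $\Delta>0$. The zero-temperature Parisi measure $\nu_P(\xi)$, given by $(\gamma_P,\Delta_P)$, is the unique minimizer over $\mathcal K$ of the Crisanti--Sommers functional $$\mathcal Q(\nu)=\frac12\Big(\int_0^1\xi'(s)\,\nu(ds)+\int_0^1\frac{dr}{\nu((r,1])}\Big).$$ As is customary, when speaking of its atoms we identify $\nu_P$ with the measure $\rho_P+\Delta_P\delta_1$, where $\rho_P$ is the measure on $[0,1)$ with $\rho_P([0,s])=\gamma_P(s)$; $\xi$ is called $k$-RSB if this measure is purely atomic with exactly $k+1$ atoms. Let $$G(\xi)=\log\frac{\xi''(1)}{\xi'(1)}-\frac{[\xi''(1)-\xi'(1)]\,[\xi''(1)-\xi'(1)+\xi'(1)^2]}{\xi''(1)\,\xi'(1)^2};$$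 $\xi$ is called pure-like if $G(\xi)>0$ and a full mixture if $G(\xi)<0$. \textbf{Theorem.} For each of the mixtures $$\tfrac57x^3+\tfrac27x^{16},\qquad \tfrac56x^3+\tfrac16x^{16},\qquad \tfrac56x^4+\tfrac16x^{40},\qquad \tfrac58x^4+\tfrac38x^{40}$$ the functional $\mathcal Q$ has a unique minimizer $\nu_P$ over $\mathcal K$ and, in the above sense, $$\nu_P=m_1\delta_0+m_2\delta_q+\Delta_P\delta_1\qquad\text{for some } m_1,m_2,\Delta_P>0,\ q\in(0,1).$$ The first and the fourth of these mixtures are pure-like, the second and the third are full mixtures. In particular, the answer to the question of Auffinger and Ben Arous whether being $1$-RSB is equivalent to being pure-like is negative, even among mixtures with $c_2=0$. -/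

import Mathlib

open MeasureTheory Set
open scoped ENNReal

noncomputable section

/-- A spherical mixed `p`-spin model, given by its coefficients `c_p ≥ 0` for `p ≥ 2`
(with `c_0 = c_1 = 0`), normalised by `∑ c_p ^ 2 = 1` and with `∑ 2 ^ p c_p < ∞`. -/
structure Mixture where
  c : ℕ → ℝ
  c_nonneg : ∀ p, 0 ≤ c p
  c_zero : c 0 = 0
  c_one : c 1 = 0
  hasSum_sq : HasSum (fun p => c p ^ 2) 1
  summable_two_pow_mul : Summable fun p => (2 : ℝ) ^ p * c p

namespace Mixture

/-- The mixture function `ξ(x) = ∑ c_p ^ 2 x ^ p`. -/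
def eval (ξ : Mixture) (x : ℝ) : ℝ := ∑' p, ξ.c p ^ 2 * x ^ p

end Mixture

/-- A pair `(γ, Δ)`: a nonnegative, nondecreasing, right-continuous function `γ` on `[0,1)`
(its values elsewhere play no role) and a number `Δ > 0`. -/
structure OrderParameter where
  γ : ℝ → ℝ
  Δ : ℝ
  γ_nonneg : ∀ s ∈ Ico (0 : ℝ) 1, 0 ≤ γ s
  γ_mono : MonotoneOn γ (Ico 0 1)
  γ_rightCont : ∀ s ∈ Ico (0 : ℝ) 1, ContinuousWithinAt γ (Ici s) s
  Δ_pos : 0 < Δ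

/-- The measure `ν(ds) = 1_{[0,1)}(s) γ(s) ds + Δ δ_1(ds)`. -/
def OrderParameter.measure (a : OrderParameter) : Measure ℝ :=
  (volume.restrict (Ico (0 : ℝ) 1)).withDensity (fun s => ENNReal.ofReal (a.γ s))
    + ENNReal.ofReal a.Δ • Measure.dirac 1

/-- The collection `𝒦` of all measures `ν(ds) = 1_{[0,1)}(s) γ(s) ds + Δ δ_1(ds)`. -/
def orderMeasures : Set (Measure ℝ) := range OrderParameter.measure

namespace Mixture

/-- The Crisanti–Sommers functional
`𝒬(ν) = (1/2) (∫_0^1 ξ'(s) ν(ds) + ∫_0^1 dr / ν((r,1]))`. Both integrands are nonnegative,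
so it is taken with values in `[0,∞]`. -/
def crisantiSommers (ξ : Mixture) (ν : Measure ℝ) : ℝ≥0∞ :=
  2⁻¹ * ((∫⁻ s in Icc (0 : ℝ) 1, ENNReal.ofReal (deriv ξ.eval s) ∂ν)
    + ∫⁻ r in Icc (0 : ℝ) 1, (ν (Ioc r 1))⁻¹)

/-- `ν` is the Parisi measure of `ξ` at zero temperature: the unique minimizer over `𝒦` of the
Crisanti–Sommers functional. -/
def IsParisiMeasure (ξ : Mixture) (ν : Measure ℝ) : Prop :=
  (ν ∈ orderMeasures ∧ IsMinOn ξ.crisantiSommers orderMeasures ν) ∧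
    ∀ ν' ∈ orderMeasures, IsMinOn ξ.crisantiSommers orderMeasures ν' → ν' = ν

end Mixture

/-- `μ = ρ + Δ δ_1`, where `ν(ds) = 1_{[0,1)}(s) γ(s) ds + Δ δ_1(ds)` and `ρ` is the measure on
`[0,1)` induced by `γ`, that is, `ρ([0,s]) = γ(s)` for `s ∈ [0,1)`. The atoms of an order
parameter are by convention those of `μ`. -/
def IsInducedMeasure (ν μ : Measure ℝ) : Prop :=
  ∃ a : OrderParameter, a.measure = ν ∧
    μ (Icc (0 : ℝ) 1)ᶜ = 0 ∧
    (∀ s ∈ Ico (0 : ℝ) 1, μ (Icc 0 s) = ENNReal.ofReal (a.γ s)) ∧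
    μ {1} = ENNReal.ofReal a.Δ

namespace Mixture

/-- `ξ` is `k`-RSB at zero temperature: its Parisi measure is purely atomic with exactly `k + 1`
atoms. -/
def IsRSB (ξ : Mixture) (k : ℕ) : Prop :=
  ∃ ν, ξ.IsParisiMeasure ν ∧
    ∃ (S : Finset ℝ) (m : ℝ → ℝ), S.card = k + 1 ∧ (∀ x ∈ S, 0 < m x) ∧
      IsInducedMeasure ν (∑ x ∈ S, ENNReal.ofReal (m x) • Measure.dirac x)

/-- The Parisi measure of `ξ` is `m₁ δ_0 + m₂ δ_q + Δ δ_1` with `m₁, m₂, Δ > 0` and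
`q ∈ (0,1)`. -/
def HasThreeAtoms (ξ : Mixture) : Prop :=
  ∃ ν, ξ.IsParisiMeasure ν ∧
    ∃ m₁ m₂ Δ q : ℝ, 0 < m₁ ∧ 0 < m₂ ∧ 0 < Δ ∧ q ∈ Ioo (0 : ℝ) 1 ∧
      IsInducedMeasure ν
        (ENNReal.ofReal m₁ • Measure.dirac 0 + ENNReal.ofReal m₂ • Measure.dirac q
          + ENNReal.ofReal Δ • Measure.dirac 1)

/-- The quantity `G` with `a = ξ'(1)`, `b = ξ''(1)`. -/
def G (ξ : Mixture) : ℝ :=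
  let a := deriv ξ.eval 1
  let b := deriv (deriv ξ.eval) 1
  Real.log (b / a) - (b - a) * (b - a + a ^ 2) / (b * a ^ 2)

def PureLike (ξ : Mixture) : Prop := 0 < ξ.G

def FullMixture (ξ : Mixture) : Prop := ξ.G < 0

end Mixture

end

/-!
Write `N(r) = ν((r,1])`. Since `1 / x` is convex, every order measure `ν'` satisfies
`∫ dr / ν'((r,1]) ≥ 2 ∫ dr / N - ∫ ν'((r,1]) / N(r)² dr`, and by Tonelli the last integral is
`∫ W dν'` with `W(s) = ∫_0^s N⁻²`. Hence `ν` minimises the Crisanti–Sommers functional as soon as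
`∫ ξ' dν' ≥ ∫ W dν'` for all `ν'`, with equality for `ν' = ν`. As `γ'` is nondecreasing, its
superlevel sets are final segments of `[0,1)`, so it is enough that `F = ξ' - W` vanishes at `1`,
has nonnegative integral over each `[t,1]`, and has integral zero over the segments that start at an
atom of `ν`. Strict convexity of `1 / x` gives uniqueness (`isParisiMeasure_twoStep`).

For atoms at `0`, `q` and `1` the tail `N` is affine on `[0,q]` and on `[q,1]`, and the equalities
`F(q) = F(1) = 0` and `∫_0^q F = ∫_q^1 F = 0` become explicit equations for `q` and the ratios
`x = N(0) / N(q)`, `X = N(q) / N(1)`, in terms of the function `logRatio`. The derivative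
`F' = ξ'' - N⁻²` has the sign of `N - (ξ'')^(-1/2)`. For a mixture of two powers, `(ξ'')^(-1/2)` is
convex, then concave, then convex; if `q` lies in the concave part and `F'(q) ≤ 0`, then `F'` has
the signs `-, +, -` on each of `[0,q]` and `[q,1]`, whence `F` is first nonpositive and then nonnegative
there, and all its integrals over final segments are nonnegative
(`OptimalityConditions.hasThreeAtoms`).

The equations are solved by the intermediate value theorem with `x` as parameter
(`exists_optimalityConditions`); its numerical hypotheses are checked for each of the four mixtures
with rational bounds for a few logarithms. A mixture whose Parisi measure has three atoms is not
`1`-RSB, so the first, pure-like mixture refutes the equivalence.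
-/

/-! ### The function `logRatio` and sign patterns -/

/-- The function `(x log x - x + 1) / (x - 1)²`, which decreases from `1/2` to `0` on `(1, ∞)`. -/
noncomputable def logRatio (x : ℝ) : ℝ := (x * Real.log x - x + 1) / (x - 1) ^ 2

theorem continuousOn_logRatio : ContinuousOn logRatio (Ioi 1) := by
  intro x hx
  have hx1 : (1 : ℝ) < x := hx
  apply ContinuousAt.continuousWithinAt
  have h0 : x ≠ 0 := by linarith
  have h1 : (x - 1) ^ 2 ≠ 0 := pow_ne_zero _ (by linarith)
  unfold logRatio
  fun_prop (disch := assumption)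

theorem antitoneOn_logRatio : AntitoneOn logRatio (Ioi 1) := by
  have hd : ∀ x ∈ Ioi (1 : ℝ), HasDerivAt logRatio
      ((x - 1) * (2 * (x - 1) - (x + 1) * Real.log x) / ((x - 1) ^ 2) ^ 2) x := by
    intro x hx
    have hx1 : (1 : ℝ) < x := hx
    have h0 : x ≠ 0 := by linarith
    have h1 : (x - 1) ^ 2 ≠ 0 := pow_ne_zero _ (by linarith)
    have h2 : HasDerivAt (fun x : ℝ => x * Real.log x - x + 1) (1 * Real.log x + x * x⁻¹ - 1) x :=
      (((hasDerivAt_id x).mul (Real.hasDerivAt_log h0)).sub (hasDerivAt_id x)).add_const 1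
    have h3 : HasDerivAt (fun x : ℝ => (x - 1) ^ 2) (2 * (x - 1)) x := by
      simpa using ((hasDerivAt_id' x).sub_const 1).fun_pow 2
    refine (h2.div h3 h1).congr_deriv ?_
    congr 1
    field_simp
    ring
  refine antitoneOn_of_deriv_nonpos (convex_Ioi 1) continuousOn_logRatio ?_ ?_
  · rw [interior_Ioi]
    exact fun x hx => (hd x hx).differentiableAt.differentiableWithinAt
  · rw [interior_Ioi]
    intro x hx
    have hx1 : (1 : ℝ) < x := hx
    rw [(hd x hx).deriv]
    apply div_nonpos_of_nonpos_of_nonneg _ (by positivity)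
    apply mul_nonpos_of_nonneg_of_nonpos (by linarith)
    have := Real.le_log_one_add_of_nonneg (x := x - 1) (by linarith)
    rw [div_le_iff₀ (by linarith), show 1 + (x - 1) = x by ring] at this
    linarith

theorem integral_inv_sq_affine {a b c M : ℝ} (hab : a ≤ b)
    (hpos : ∀ s ∈ Icc a b, 0 < c - M * s) :
    ∫ s in a..b, ((c - M * s) ^ 2)⁻¹ = (b - a) / ((c - M * a) * (c - M * b)) := by
  have ha := hpos a ⟨le_rfl, hab⟩
  have hd : ∀ s ∈ uIcc a b, HasDerivAt (fun s => (s - a) / ((c - M * a) * (c - M * s)))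
      (((c - M * s) ^ 2)⁻¹) s := by
    intro s hs
    rw [uIcc_of_le hab] at hs
    have hs' := hpos s hs
    have h1 : HasDerivAt (fun s => (c - M * a) * (c - M * s)) ((c - M * a) * (-M)) s := by
      simpa using (((hasDerivAt_id s).const_mul M).const_sub c).const_mul (c - M * a)
    refine (((hasDerivAt_id s).sub_const a).div h1 (by positivity)).congr_deriv ?_
    simp only [id]
    field_simp
    ring
  rw [intervalIntegral.integral_eq_sub_of_hasDerivAt hd]
  · simp
  · apply ContinuousOn.intervalIntegrable
    rw [uIcc_of_le hab]
    intro s hs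
    have := hpos s hs
    apply ContinuousAt.continuousWithinAt
    fun_prop (disch := positivity)

/-- The integrand is `∫_a^s dr / (c - M r) ^ 2`, in the closed form of `integral_inv_sq_affine`. -/
theorem integral_integral_inv_sq_affine {a b c M : ℝ} (hab : a < b) (hM : 0 < M)
    (hpos : ∀ s ∈ Icc a b, 0 < c - M * s) :
    ∫ s in a..b, (s - a) / ((c - M * a) * (c - M * s)) =
      (b - a) * ((b - a) / ((c - M * a) * (c - M * b))) *
        logRatio ((c - M * a) / (c - M * b)) := by
  have ha := hpos a ⟨le_rfl, hab.le⟩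
  have hb := hpos b ⟨hab.le, le_rfl⟩
  have hd : ∀ s ∈ uIcc a b, HasDerivAt
      (fun s => -(Real.log (c - M * s) / M ^ 2) - s / (M * (c - M * a)))
      ((s - a) / ((c - M * a) * (c - M * s))) s := by
    intro s hs
    rw [uIcc_of_le hab.le] at hs
    have hs' := hpos s hs
    have h1 : HasDerivAt (fun s => c - M * s) (-M) s := by
      simpa using ((hasDerivAt_id s).const_mul M).const_sub c
    refine (((h1.log hs'.ne').div_const (M ^ 2)).neg.sub
      ((hasDerivAt_id s).div_const (M * (c - M * a)))).congr_deriv ?_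
    field_simp
    ring
  rw [intervalIntegral.integral_eq_sub_of_hasDerivAt hd]
  · rw [logRatio, Real.log_div ha.ne' hb.ne']
    have hne : (c - M * a) / (c - M * b) - 1 = M * (b - a) / (c - M * b) := by
      field_simp
      ring
    have hba : b - a ≠ 0 := by linarith
    rw [hne]
    generalize Real.log (c - M * a) = la
    generalize Real.log (c - M * b) = lb
    field_simp
    ring
  · apply ContinuousOn.intervalIntegrable
    rw [uIcc_of_le hab.le]
    intro s hs
    have := hpos s hs
    apply ContinuousAt.continuousWithinAt
    fun_prop (disch := positivity)

/-- A function that vanishes at both ends of an interval, has integral zero, and is successively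
decreasing, increasing and decreasing is first nonpositive and then nonnegative; so its integrals
over final segments are nonnegative. -/
theorem integral_nonneg_of_antitone_monotone_antitone {F : ℝ → ℝ} {a b p₁ p₂ : ℝ}
    (h₁ : a ≤ p₁) (h₃ : p₂ ≤ b) (hc : ContinuousOn F (Icc a b))
    (hF₁ : AntitoneOn F (Icc a p₁)) (hF₂ : MonotoneOn F (Icc p₁ p₂))
    (hF₃ : AntitoneOn F (Icc p₂ b)) (ha : F a = 0) (hb : F b = 0)
    (hint : ∫ s in a..b, F s = 0) {t : ℝ} (ht : t ∈ Icc a b) :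
    0 ≤ ∫ s in t..b, F s := by
  have hneg : ∀ s ∈ Icc a p₁, F s ≤ 0 := fun s hs =>
    (hF₁ ⟨le_rfl, h₁⟩ hs hs.1).trans_eq ha
  have hpos : ∀ s ∈ Icc p₂ b, 0 ≤ F s := fun s hs =>
    hb.symm.le.trans (hF₃ hs ⟨h₃, le_rfl⟩ hs.2)
  have hsplit : (∫ s in a..t, F s) + ∫ s in t..b, F s = 0 := by
    rw [← hint]
    apply intervalIntegral.integral_add_adjacent_intervals
    · apply ContinuousOn.intervalIntegrable
      rw [uIcc_of_le ht.1]
      exact hc.mono (Icc_subset_Icc le_rfl ht.2)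
    · apply ContinuousOn.intervalIntegrable
      rw [uIcc_of_le ht.2]
      exact hc.mono (Icc_subset_Icc ht.1 le_rfl)
  have key : (∀ s ∈ Icc a t, F s ≤ 0) ∨ ∀ s ∈ Icc t b, 0 ≤ F s := by
    rcases le_total t p₁ with h | h
    · exact Or.inl fun s hs => hneg s ⟨hs.1, hs.2.trans h⟩
    rcases le_total p₂ t with h' | h'
    · exact Or.inr fun s hs => hpos s ⟨h'.trans hs.1, hs.2⟩
    rcases le_total (F t) 0 with h0 | h0
    · refine Or.inl fun s hs => ?_
      rcases le_total s p₁ with h4 | h4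
      · exact hneg s ⟨hs.1, h4⟩
      · exact (hF₂ ⟨h4, hs.2.trans h'⟩ ⟨h, h'⟩ hs.2).trans h0
    · refine Or.inr fun s hs => ?_
      rcases le_total p₂ s with h4 | h4
      · exact hpos s ⟨h4, hs.2⟩
      · exact h0.trans (hF₂ ⟨h, h'⟩ ⟨h.trans hs.1, h4⟩ hs.1)
  rcases key with h | h
  · have : 0 ≤ ∫ s in a..t, -F s :=
      intervalIntegral.integral_nonneg ht.1 fun s hs => neg_nonneg.2 (h s hs)
    rw [intervalIntegral.integral_neg] at this
    linarith
  · exact intervalIntegral.integral_nonneg ht.2 h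

theorem ConvexOn.exists_sublevel_eq_Icc {D : ℝ → ℝ} {c b : ℝ} (hD : ConvexOn ℝ (Icc c b) D)
    (hc : ContinuousOn D (Icc c b)) {s : ℝ} (hs : s ∈ Icc c b) (hs0 : D s ≤ 0) :
    ∃ p₁ p₂, p₁ ≤ p₂ ∧ c ≤ p₁ ∧ p₂ ≤ b ∧ ∀ x ∈ Icc c b, D x ≤ 0 ↔ x ∈ Icc p₁ p₂ := by
  set S := {x ∈ Icc c b | D x ≤ 0} with hS
  have hconv : Convex ℝ S := hD.convex_le 0
  have hcl : IsClosed S :=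
    hc.preimage_isClosed_of_isClosed isClosed_Icc (isClosed_Iic (a := (0 : ℝ)))
  have hcpt : IsCompact S := isCompact_Icc.of_isClosed_subset hcl (sep_subset _ _)
  have hne : S.Nonempty := ⟨s, hs, hs0⟩
  have hIcc := eq_Icc_of_connected_compact ⟨hne, hconv.isPreconnected⟩ hcpt
  have hle : sInf S ≤ sSup S := by
    rw [← nonempty_Icc, ← hIcc]
    exact hne
  have hl : sInf S ∈ S := hcpt.sInf_mem hne
  have hr : sSup S ∈ S := hcpt.sSup_mem hne
  refine ⟨sInf S, sSup S, hle, hl.1.1, hr.1.2, fun x hx => ?_⟩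
  rw [← hIcc]
  exact ⟨fun h => ⟨hx, h⟩, fun h => h.2⟩

/-- A function that is nonnegative on the left, then concave, then convex changes sign at most
twice. -/
theorem exists_sign_pattern_of_concaveOn_convexOn {D : ℝ → ℝ} {a b c : ℝ} (hac : a ≤ c)
    (hcb : c ≤ b) (hD : ContinuousOn D (Icc a b)) (h₁ : ConcaveOn ℝ (Icc a c) D)
    (h₂ : ConvexOn ℝ (Icc c b) D) (ha : 0 ≤ D a) :
    ∃ p₁ p₂, a ≤ p₁ ∧ p₁ ≤ p₂ ∧ p₂ ≤ b ∧ (∀ s ∈ Ioo a p₁, 0 ≤ D s) ∧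
      (∀ s ∈ Ioo p₁ p₂, D s ≤ 0) ∧ ∀ s ∈ Ioo p₂ b, 0 ≤ D s := by
  have hDl := hD.mono (Icc_subset_Icc le_rfl hcb)
  have hDr := hD.mono (Icc_subset_Icc hac le_rfl)
  rcases le_or_gt 0 (D c) with h | h
  · have hl : ∀ s ∈ Icc a c, 0 ≤ D s := fun s hs =>
      (h₁.convex_ge 0).ordConnected.out ⟨⟨le_rfl, hac⟩, ha⟩ ⟨⟨hac, le_rfl⟩, h⟩ hs |>.2
    by_cases hex : ∃ s ∈ Icc c b, D s ≤ 0
    · obtain ⟨s, hs, hs0⟩ := hex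
      obtain ⟨p₁, p₂, h12, hc1, h2b, hiff⟩ := h₂.exists_sublevel_eq_Icc hDr hs hs0
      refine ⟨p₁, p₂, hac.trans hc1, h12, h2b, fun x hx => ?_, fun x hx => ?_, fun x hx => ?_⟩
      · rcases le_total x c with hxc | hxc
        · exact hl x ⟨hx.1.le, hxc⟩
        · by_contra hneg
          have := (hiff x ⟨hxc, hx.2.le.trans (h12.trans h2b)⟩).1 (by linarith)
          exact absurd this.1 (not_le.2 hx.2)
      · exact (hiff x ⟨hc1.trans hx.1.le, hx.2.le.trans h2b⟩).2 ⟨hx.1.le, hx.2.le⟩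
      · by_contra! hneg
        have := (hiff x ⟨hc1.trans (h12.trans hx.1.le), hx.2.le⟩).1 hneg.le
        exact absurd this.2 (not_le.2 hx.1)
    · push Not at hex
      refine ⟨b, b, hac.trans hcb, le_rfl, le_rfl, fun s hs => ?_, ?_, ?_⟩
      · rcases le_total s c with hsc | hsc
        · exact hl s ⟨hs.1.le, hsc⟩
        · exact (hex s ⟨hsc, hs.2.le⟩).le
      · simp
      · simp
  · obtain ⟨r₁, r₂, h12, hr1, hr2, hiff⟩ := h₁.neg.exists_sublevel_eq_Icc hDl.neg
      ⟨le_rfl, hac⟩ (by simpa using ha)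
    have hr1a : r₁ ≤ a := ((hiff a ⟨le_rfl, hac⟩).1 (by simpa using ha)).1
    obtain ⟨p₁, p₂, hp12, hp1, hp2, hiff'⟩ := h₂.exists_sublevel_eq_Icc hDr ⟨le_rfl, hcb⟩ h.le
    have hcp : c ∈ Icc p₁ p₂ := (hiff' c ⟨le_rfl, hcb⟩).1 h.le
    refine ⟨r₂, p₂, hr1.trans h12, hr2.trans hcp.2, hp2, fun s hs => ?_, fun s hs => ?_,
      fun s hs => ?_⟩
    · simpa using (hiff s ⟨hs.1.le, hs.2.le.trans hr2⟩).2 ⟨hr1a.trans hs.1.le, hs.2.le⟩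
    · rcases le_total s c with hsc | hsc
      · by_contra! hneg
        have := (hiff s ⟨(hr1.trans h12).trans hs.1.le, hsc⟩).1 (by simpa using hneg.le)
        exact absurd this.2 (not_le.2 hs.1)
      · exact (hiff' s ⟨hsc, hs.2.le.trans hp2⟩).2 ⟨hcp.1.trans hsc, hs.2.le⟩
    · by_contra! hneg
      have := (hiff' s ⟨hcp.2.trans hs.1.le, hs.2.le⟩).1 hneg.le
      exact absurd this.2 (not_le.2 hs.1)

theorem exists_sign_pattern_of_convexOn_concaveOn {D : ℝ → ℝ} {a b c : ℝ} (hac : a ≤ c)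
    (hcb : c ≤ b) (hD : ContinuousOn D (Icc a b)) (h₁ : ConvexOn ℝ (Icc a c) D)
    (h₂ : ConcaveOn ℝ (Icc c b) D) (hb : 0 ≤ D b) :
    ∃ p₁ p₂, a ≤ p₁ ∧ p₁ ≤ p₂ ∧ p₂ ≤ b ∧ (∀ s ∈ Ioo a p₁, 0 ≤ D s) ∧
      (∀ s ∈ Ioo p₁ p₂, D s ≤ 0) ∧ ∀ s ∈ Ioo p₂ b, 0 ≤ D s := by
  have hpre : ∀ u v : ℝ, (-LinearMap.id : ℝ →ₗ[ℝ] ℝ) ⁻¹' Icc u v = Icc (-v) (-u) := by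
    intro u v
    ext x
    simp [and_comm, neg_le, le_neg]
  obtain ⟨p₁, p₂, h1, h2, h3, hp1, hp2, hp3⟩ :=
    exists_sign_pattern_of_concaveOn_convexOn (D := fun s => D (-s)) (a := -b) (b := -a) (c := -c)
      (by linarith) (by linarith)
      (hD.comp continuous_neg.continuousOn fun x hx => ⟨by linarith [hx.2], by linarith [hx.1]⟩)
      (by
        have := h₂.comp_linearMap (-LinearMap.id)
        rwa [hpre] at this)
      (by
        have := h₁.comp_linearMap (-LinearMap.id)
        rwa [hpre] at this)
      (by simpa using hb)
  refine ⟨-p₂, -p₁, by linarith, by linarith, by linarith, fun s hs => ?_, fun s hs => ?_,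
    fun s hs => ?_⟩
  · simpa using hp3 (-s) ⟨by linarith [hs.2], by linarith [hs.1]⟩
  · simpa using hp2 (-s) ⟨by linarith [hs.2], by linarith [hs.1]⟩
  · simpa using hp1 (-s) ⟨by linarith [hs.2], by linarith [hs.1]⟩

/-! ### Convexity of `(ξ'')^(-1/2)` for a sum of two powers -/

/-- With `y = (β / α) s ^ (m - e)`, this quadratic polynomial in `y` has the sign of the second
derivative of `(α s ^ e + β s ^ m) ^ (-1/2)`. -/
def curvature (e m y : ℝ) : ℝ := 3 * (e + m * y) ^ 2 - 2 * (1 + y) * (e * (e - 1) + m * (m - 1) * y)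

theorem convexOn_curvature {e m : ℝ} (hm : 0 ≤ m) : ConvexOn ℝ univ (curvature e m) := by
  refine ⟨convex_univ, fun x _ y _ s t hs ht hst => ?_⟩
  obtain rfl : t = 1 - s := by linarith
  have : 0 ≤ (m ^ 2 + 2 * m) * (s * (1 - s) * (x - y) ^ 2) := by positivity
  simp only [curvature, smul_eq_mul]
  linarith

theorem curvature_nonpos_of_between {e m x y z : ℝ} (hm : 0 ≤ m) (hx : curvature e m x ≤ 0)
    (hz : curvature e m z ≤ 0) (hy : y ∈ Icc x z) : curvature e m y ≤ 0 :=
  (((convexOn_curvature hm).convex_le 0).ordConnected.out ⟨mem_univ x, hx⟩ ⟨mem_univ z, hz⟩ hy).2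

theorem curvature_neg_of_between {e m x y z : ℝ} (hm : 0 ≤ m) (hx : curvature e m x < 0)
    (hz : curvature e m z < 0) (hy : y ∈ Icc x z) : curvature e m y < 0 :=
  (((convexOn_curvature hm).convex_lt 0).ordConnected.out ⟨mem_univ x, hx⟩ ⟨mem_univ z, hz⟩ hy).2

section TwoPowers

variable {α β : ℝ} {e k : ℕ}

theorem hasDerivAt_pow_div (n : ℕ) {s : ℝ} (hs : s ≠ 0) :
    HasDerivAt (fun s : ℝ => s ^ n) (n * s ^ n / s) s := by
  refine (hasDerivAt_pow n s).congr_deriv ?_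
  rcases n with _ | n
  · simp
  · field_simp
    simp [pow_succ]

theorem twoPowers_pos (hα : 0 < α) (hβ : 0 < β) {s : ℝ} (hs : 0 < s) :
    0 < α * s ^ e + β * s ^ (e + k) := by positivity

/-- The second derivative of `(α s ^ e + β s ^ (e + k)) ^ (-1/2)`, given as the derivative of an
explicit first derivative. -/
theorem hasDerivAt_twoPowers_rpow (hα : 0 < α) (hβ : 0 < β) {s : ℝ} (hs : 0 < s) :
    HasDerivAt (fun s : ℝ => (α * s ^ e + β * s ^ (e + k)) ^ (-(1 / 2) : ℝ))
      (-(1 / 2) * ((e * α * s ^ e + (e + k) * β * s ^ (e + k)) / s) *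
        (α * s ^ e + β * s ^ (e + k)) ^ (-(3 / 2) : ℝ)) s ∧
    HasDerivAt (fun s : ℝ => -(1 / 2) * ((e * α * s ^ e + (e + k) * β * s ^ (e + k)) / s) *
        (α * s ^ e + β * s ^ (e + k)) ^ (-(3 / 2) : ℝ))
      (1 / 4 * (α * s ^ e / s) ^ 2 * (α * s ^ e + β * s ^ (e + k)) ^ (-(5 / 2) : ℝ) *
        curvature e (e + k) (β / α * s ^ k)) s := by
  have hφ : 0 < α * s ^ e + β * s ^ (e + k) := twoPowers_pos hα hβ hs
  have h1 : HasDerivAt (fun s : ℝ => α * s ^ e + β * s ^ (e + k))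
      ((e * α * s ^ e + (e + k) * β * s ^ (e + k)) / s) s := by
    refine (((hasDerivAt_pow_div e hs.ne').const_mul α).add
      ((hasDerivAt_pow_div (e + k) hs.ne').const_mul β)).congr_deriv ?_
    push_cast
    ring
  have h2 : HasDerivAt (fun s : ℝ => (e * α * s ^ e + (e + k) * β * s ^ (e + k)) / s)
      ((e * (e - 1) * α * s ^ e + (e + k) * (e + k - 1) * β * s ^ (e + k)) / s ^ 2) s := by
    refine ((((hasDerivAt_pow_div e hs.ne').const_mul (e * α)).add
      ((hasDerivAt_pow_div (e + k) hs.ne').const_mul ((e + k) * β))).fun_div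
        (hasDerivAt_id' s) hs.ne').congr_deriv ?_
    push_cast
    field_simp
    simp only [Pi.add_apply]
    ring
  constructor
  · refine (h1.rpow_const (p := -(1 / 2)) (Or.inl hφ.ne')).congr_deriv ?_
    rw [show (-(1 / 2) - 1 : ℝ) = -(3 / 2) by norm_num]
    ring
  · refine ((h2.const_mul (-(1 / 2))).mul
      (h1.rpow_const (p := -(3 / 2)) (Or.inl hφ.ne'))).congr_deriv ?_
    rw [show (-(3 / 2) - 1 : ℝ) = -(5 / 2) by norm_num,
      show (-(3 / 2) : ℝ) = 1 + -(5 / 2) by norm_num, Real.rpow_add hφ, Real.rpow_one]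
    generalize (α * s ^ e + β * s ^ (e + k)) ^ (-(5 / 2) : ℝ) = z
    simp only [curvature, pow_add]
    field_simp
    ring

theorem convexOn_twoPowers_rpow (hα : 0 < α) (hβ : 0 < β) {u v : ℝ} (hu : 0 < u)
    (h : ∀ s ∈ Icc u v, 0 ≤ curvature e (e + k) (β / α * s ^ k)) :
    ConvexOn ℝ (Icc u v) fun s => (α * s ^ e + β * s ^ (e + k)) ^ (-(1 / 2) : ℝ) := by
  have hpos : ∀ s ∈ interior (Icc u v), 0 < s := fun s hs => hu.trans_le (interior_subset hs).1
  refine convexOn_of_hasDerivWithinAt2_nonneg (convex_Icc u v) (fun s hs =>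
    (hasDerivAt_twoPowers_rpow hα hβ (hu.trans_le hs.1)).1.continuousAt.continuousWithinAt)
    (fun s hs => (hasDerivAt_twoPowers_rpow hα hβ (hpos s hs)).1.hasDerivWithinAt)
    (fun s hs => (hasDerivAt_twoPowers_rpow hα hβ (hpos s hs)).2.hasDerivWithinAt)
    fun s hs => ?_
  have := twoPowers_pos (e := e) (k := k) hα hβ (hpos s hs)
  exact mul_nonneg (by positivity) (h s (interior_subset hs))

theorem concaveOn_twoPowers_rpow (hα : 0 < α) (hβ : 0 < β) {u v : ℝ} (hu : 0 < u)
    (h : ∀ s ∈ Icc u v, curvature e (e + k) (β / α * s ^ k) ≤ 0) :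
    ConcaveOn ℝ (Icc u v) fun s => (α * s ^ e + β * s ^ (e + k)) ^ (-(1 / 2) : ℝ) := by
  have hpos : ∀ s ∈ interior (Icc u v), 0 < s := fun s hs => hu.trans_le (interior_subset hs).1
  refine concaveOn_of_hasDerivWithinAt2_nonpos (convex_Icc u v) (fun s hs =>
    (hasDerivAt_twoPowers_rpow hα hβ (hu.trans_le hs.1)).1.continuousAt.continuousWithinAt)
    (fun s hs => (hasDerivAt_twoPowers_rpow hα hβ (hpos s hs)).1.hasDerivWithinAt)
    (fun s hs => (hasDerivAt_twoPowers_rpow hα hβ (hpos s hs)).2.hasDerivWithinAt)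
    fun s hs => ?_
  have := twoPowers_pos (e := e) (k := k) hα hβ (hpos s hs)
  exact mul_nonpos_of_nonneg_of_nonpos (by positivity) (h s (interior_subset hs))

theorem continuous_curvature_twoPowers :
    Continuous fun s : ℝ => curvature e (e + k) (β / α * s ^ k) := by
  unfold curvature
  fun_prop

/-- Since `curvature` is convex and negative at the value that corresponds to `q`, it changes sign
at most once to the right of `q`. -/
theorem exists_concave_convex_split (hα : 0 < α) (hβ : 0 < β) (hk : k ≠ 0) {q b : ℝ} (hq : 0 < q)
    (hqb : q ≤ b) (hcurv : curvature e (e + k) (β / α * q ^ k) < 0) :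
    ∃ c ∈ Icc q b, (∀ s ∈ Icc q c, curvature e (e + k) (β / α * s ^ k) ≤ 0) ∧
      (c = b ∨ ∀ s ∈ Icc c b, 0 ≤ curvature e (e + k) (β / α * s ^ k)) := by
  have hm : (0 : ℝ) ≤ e + k := by positivity
  have hmono : ∀ {s t : ℝ}, 0 < s → s ≤ t → β / α * s ^ k ≤ β / α * t ^ k := by
    intro s t hs hst
    gcongr
  rcases le_or_gt (curvature e (e + k) (β / α * b ^ k)) 0 with h | h
  · exact ⟨b, ⟨hqb, le_rfl⟩, fun s hs => curvature_nonpos_of_between hm hcurv.le h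
      ⟨hmono hq hs.1, hmono (hq.trans_le hs.1) hs.2⟩, Or.inl rfl⟩
  · obtain ⟨c, hc, hc0⟩ := intermediate_value_Icc hqb
      (continuous_curvature_twoPowers (α := α) (β := β) (e := e) (k := k)).continuousOn
      ⟨hcurv.le, h.le⟩
    simp only at hc0
    refine ⟨c, hc, fun s hs => curvature_nonpos_of_between hm hcurv.le hc0.le
      ⟨hmono hq hs.1, hmono (hq.trans_le hs.1) hs.2⟩, Or.inr fun s hs => ?_⟩
    by_contra! hneg
    exact (curvature_neg_of_between hm hcurv hneg
      ⟨hmono hq hc.1, hmono (hq.trans_le hc.1) hs.1⟩).ne hc0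

/-- Since `curvature` is convex, positive at `0` and negative at the value that corresponds to `q`,
it changes sign exactly once to the left of `q`. -/
theorem exists_convex_concave_split (hα : 0 < α) (hβ : 0 < β) (hk : k ≠ 0) (he : e ≠ 0) {q : ℝ}
    (hq : 0 < q) (hcurv : curvature e (e + k) (β / α * q ^ k) < 0) :
    ∃ c ∈ Ioc 0 q, (∀ s ∈ Ioc 0 c, 0 ≤ curvature e (e + k) (β / α * s ^ k)) ∧
      ∀ s ∈ Icc c q, curvature e (e + k) (β / α * s ^ k) ≤ 0 := by
  have hm : (0 : ℝ) ≤ e + k := by positivity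
  have hmono : ∀ {s t : ℝ}, 0 ≤ s → s ≤ t → β / α * s ^ k ≤ β / α * t ^ k := by
    intro s t hs hst
    gcongr
  have h0 : 0 < curvature e (e + k) (β / α * (0 : ℝ) ^ k) := by
    have he' : (0 : ℝ) < e := by exact_mod_cast Nat.pos_of_ne_zero he
    have : curvature e (e + k) (β / α * (0 : ℝ) ^ k) = (e : ℝ) ^ 2 + 2 * e := by
      rw [zero_pow hk, curvature]
      ring
    rw [this]
    positivity
  obtain ⟨c, hc, hc0⟩ := intermediate_value_Icc' hq.le
    (continuous_curvature_twoPowers (α := α) (β := β) (e := e) (k := k)).continuousOn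
    ⟨hcurv.le, h0.le⟩
  simp only at hc0
  have hcpos : 0 < c := by
    refine hc.1.lt_of_ne ?_
    rintro rfl
    exact h0.ne' hc0
  refine ⟨c, ⟨hcpos, hc.2⟩, fun s hs => ?_, fun s hs => curvature_nonpos_of_between hm hc0.le
    hcurv.le ⟨hmono hcpos.le hs.1, hmono (hcpos.le.trans hs.1) hs.2⟩⟩
  by_contra! hneg
  exact (curvature_neg_of_between hm hneg hcurv
    ⟨hmono hs.1.le hs.2, hmono hcpos.le hc.2⟩).ne hc0

/-- Comparing `x` with `L⁻²` amounts to comparing `x ^ (-1/2)` with `L`, which is where convexity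
can be used when `L` is affine. -/
theorem rpow_neg_half_sub_nonneg_iff {x L : ℝ} (hx : 0 < x) (hL : 0 < L) :
    0 ≤ x ^ (-(1 / 2) : ℝ) - L ↔ x ≤ (L ^ 2)⁻¹ := by
  rw [Real.rpow_neg hx.le, ← Real.sqrt_eq_rpow, sub_nonneg, le_inv_comm₀ hL (Real.sqrt_pos.2 hx),
    Real.sqrt_le_left (by positivity), inv_pow]

theorem rpow_neg_half_sub_nonpos_iff {x L : ℝ} (hx : 0 < x) (hL : 0 < L) :
    x ^ (-(1 / 2) : ℝ) - L ≤ 0 ↔ (L ^ 2)⁻¹ ≤ x := by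
  rw [Real.rpow_neg hx.le, ← Real.sqrt_eq_rpow, sub_nonpos, inv_le_comm₀ (Real.sqrt_pos.2 hx) hL,
    Real.le_sqrt' (by positivity), inv_pow]

theorem continuousOn_twoPowers_rpow_sub (hα : 0 < α) (hβ : 0 < β) {c M u v : ℝ} (hu : 0 < u) :
    ContinuousOn (fun s => (α * s ^ e + β * s ^ (e + k)) ^ (-(1 / 2) : ℝ) - (c - M * s))
      (Icc u v) := fun _ hs =>
  ((hasDerivAt_twoPowers_rpow hα hβ (hu.trans_le hs.1)).1.continuousAt.sub
    (by fun_prop)).continuousWithinAt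

theorem concaveOn_affine (c M : ℝ) {s : Set ℝ} (hs : Convex ℝ s) :
    ConcaveOn ℝ s fun x => c - M * x :=
  ⟨hs, fun x _ y _ a b _ _ hab => by
    obtain rfl : b = 1 - a := by linarith
    simp only [smul_eq_mul]
    linarith⟩

theorem convexOn_affine (c M : ℝ) {s : Set ℝ} (hs : Convex ℝ s) :
    ConvexOn ℝ s fun x => c - M * x :=
  ⟨hs, fun x _ y _ a b _ _ hab => by
    obtain rfl : b = 1 - a := by linarith
    simp only [smul_eq_mul]
    linarith⟩

/-- The derivative of `F` need only have the stated signs in the interior of the three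
subintervals. -/
theorem integral_nonneg_of_hasDerivAt_sign {F F' : ℝ → ℝ} {a b p₁ p₂ : ℝ}
    (h₁ : a ≤ p₁) (h₂ : p₁ ≤ p₂) (h₃ : p₂ ≤ b) (hc : ContinuousOn F (Icc a b))
    (hd : ∀ s ∈ Ioo a b, HasDerivAt F (F' s) s) (hF₁ : ∀ s ∈ Ioo a p₁, F' s ≤ 0)
    (hF₂ : ∀ s ∈ Ioo p₁ p₂, 0 ≤ F' s) (hF₃ : ∀ s ∈ Ioo p₂ b, F' s ≤ 0) (ha : F a = 0)
    (hb : F b = 0) (hint : ∫ s in a..b, F s = 0) {t : ℝ} (ht : t ∈ Icc a b) :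
    0 ≤ ∫ s in t..b, F s := by
  refine integral_nonneg_of_antitone_monotone_antitone h₁ h₃ hc ?_ ?_ ?_ ha hb hint ht
  · refine antitoneOn_of_hasDerivWithinAt_nonpos (f' := F') (convex_Icc _ _)
      (hc.mono (Icc_subset_Icc le_rfl (h₂.trans h₃))) ?_ ?_ <;> rw [interior_Icc]
    · exact fun s hs => (hd s ⟨hs.1, hs.2.trans_le (h₂.trans h₃)⟩).hasDerivWithinAt
    · exact hF₁
  · refine monotoneOn_of_hasDerivWithinAt_nonneg (f' := F') (convex_Icc _ _)
      (hc.mono (Icc_subset_Icc h₁ h₃)) ?_ ?_ <;> rw [interior_Icc]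
    · exact fun s hs => (hd s ⟨h₁.trans_lt hs.1, hs.2.trans_le h₃⟩).hasDerivWithinAt
    · exact hF₂
  · refine antitoneOn_of_hasDerivWithinAt_nonpos (f' := F') (convex_Icc _ _)
      (hc.mono (Icc_subset_Icc (h₁.trans h₂) le_rfl)) ?_ ?_ <;> rw [interior_Icc]
    · exact fun s hs => (hd s ⟨(h₁.trans h₂).trans_lt hs.1, hs.2⟩).hasDerivWithinAt
    · exact hF₃

/-- To the right of the interior atom `q`, the function `(α s ^ e + β s ^ (e + k)) ^ (-1/2)` is
concave and then convex, so it crosses an affine function at most twice. -/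
theorem integral_nonneg_right (hα : 0 < α) (hβ : 0 < β) (hk : k ≠ 0) {q b c M : ℝ} (hq : 0 < q)
    (hqb : q ≤ b) (hcurv : curvature e (e + k) (β / α * q ^ k) < 0)
    (hL : ∀ s ∈ Icc q b, 0 < c - M * s)
    (hqL : α * q ^ e + β * q ^ (e + k) ≤ ((c - M * q) ^ 2)⁻¹) {F : ℝ → ℝ}
    (hc : ContinuousOn F (Icc q b))
    (hd : ∀ s ∈ Ioo q b,
      HasDerivAt F (α * s ^ e + β * s ^ (e + k) - ((c - M * s) ^ 2)⁻¹) s)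
    (hFq : F q = 0) (hFb : F b = 0) (hint : ∫ s in q..b, F s = 0) {t : ℝ} (ht : t ∈ Icc q b) :
    0 ≤ ∫ s in t..b, F s := by
  obtain ⟨r, hr, hr1, hr2⟩ := exists_concave_convex_split hα hβ hk hq hqb hcurv
  have hr0 : 0 < r := hq.trans_le hr.1
  have hφ : ∀ s ∈ Icc q b, 0 < α * s ^ e + β * s ^ (e + k) := fun s hs =>
    twoPowers_pos hα hβ (hq.trans_le hs.1)
  have hconv : ConvexOn ℝ (Icc r b) fun s => (α * s ^ e + β * s ^ (e + k)) ^ (-(1 / 2) : ℝ) := by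
    rcases hr2 with rfl | h
    · rw [Icc_self]
      refine ⟨convex_singleton _, ?_⟩
      rintro x rfl y rfl u v - - huv
      simp [← add_mul, huv]
    · exact convexOn_twoPowers_rpow hα hβ hr0 h
  obtain ⟨p₁, p₂, h1, h2, h3, hp1, hp2, hp3⟩ := exists_sign_pattern_of_concaveOn_convexOn hr.1 hr.2
    (continuousOn_twoPowers_rpow_sub (e := e) (k := k) (c := c) (M := M) hα hβ hq)
    ((concaveOn_twoPowers_rpow hα hβ hq hr1).sub (convexOn_affine c M (convex_Icc _ _)))
    (hconv.sub (concaveOn_affine c M (convex_Icc _ _)))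
    ((rpow_neg_half_sub_nonneg_iff (hφ q ⟨le_rfl, hqb⟩) (hL q ⟨le_rfl, hqb⟩)).2 hqL)
  have hnn : ∀ s ∈ Icc q b, 0 ≤ (α * s ^ e + β * s ^ (e + k)) ^ (-(1 / 2) : ℝ) - (c - M * s) →
      α * s ^ e + β * s ^ (e + k) - ((c - M * s) ^ 2)⁻¹ ≤ 0 := fun s hs h =>
    sub_nonpos.2 ((rpow_neg_half_sub_nonneg_iff (hφ s hs) (hL s hs)).1 h)
  have hnp : ∀ s ∈ Icc q b, (α * s ^ e + β * s ^ (e + k)) ^ (-(1 / 2) : ℝ) - (c - M * s) ≤ 0 →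
      0 ≤ α * s ^ e + β * s ^ (e + k) - ((c - M * s) ^ 2)⁻¹ := fun s hs h =>
    sub_nonneg.2 ((rpow_neg_half_sub_nonpos_iff (hφ s hs) (hL s hs)).1 h)
  exact integral_nonneg_of_hasDerivAt_sign h1 h2 h3 hc hd
    (fun s hs => hnn s ⟨hs.1.le, hs.2.le.trans (h2.trans h3)⟩ (hp1 s hs))
    (fun s hs => hnp s ⟨h1.trans hs.1.le, hs.2.le.trans h3⟩ (hp2 s hs))
    (fun s hs => hnn s ⟨(h1.trans h2).trans hs.1.le, hs.2.le⟩ (hp3 s hs)) hFq hFb hint ht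

/-- To the left of the interior atom `q`, the function `(α s ^ e + β s ^ (e + k)) ^ (-1/2)` is
convex and then concave, so it crosses an affine function at most twice. -/
theorem integral_nonneg_left (hα : 0 < α) (hβ : 0 < β) (hk : k ≠ 0) (he : e ≠ 0) {q c M : ℝ}
    (hq : 0 < q) (hcurv : curvature e (e + k) (β / α * q ^ k) < 0)
    (hL : ∀ s ∈ Icc 0 q, 0 < c - M * s)
    (hqL : α * q ^ e + β * q ^ (e + k) ≤ ((c - M * q) ^ 2)⁻¹) {F : ℝ → ℝ}
    (hc : ContinuousOn F (Icc 0 q))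
    (hd : ∀ s ∈ Ioo 0 q,
      HasDerivAt F (α * s ^ e + β * s ^ (e + k) - ((c - M * s) ^ 2)⁻¹) s)
    (hF0 : F 0 = 0) (hFq : F q = 0) (hint : ∫ s in (0 : ℝ)..q, F s = 0) {t : ℝ}
    (ht : t ∈ Icc 0 q) :
    0 ≤ ∫ s in t..q, F s := by
  obtain ⟨r, hr, hr1, hr2⟩ := exists_convex_concave_split hα hβ hk he hq hcurv
  -- near `0` the function `α s ^ e + β s ^ (e + k)` is small, so the convexity argument is only
  -- needed away from `0`, where its power `-1/2` is finite
  have hsmall : ∀ᶠ s in nhdsWithin (0 : ℝ) (Ioi 0),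
      α * s ^ e + β * s ^ (e + k) < ((c - M * s) ^ 2)⁻¹ := by
    apply Filter.Eventually.filter_mono nhdsWithin_le_nhds
    have hc0 : 0 < c - M * 0 := hL 0 ⟨le_rfl, hq.le⟩
    have hne : (c - M * 0) ^ 2 ≠ 0 := by positivity
    refine ContinuousAt.eventually_lt (by fun_prop) (by fun_prop (disch := assumption)) ?_
    simp only [zero_pow he, zero_pow (show e + k ≠ 0 by omega), mul_zero, add_zero]
    rw [mul_zero] at hc0
    positivity
  obtain ⟨ε', hε', hsub⟩ := mem_nhdsGT_iff_exists_Ioo_subset.1 hsmall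
  obtain ⟨ε, hε0, hεr, hεsmall⟩ : ∃ ε, 0 < ε ∧ ε ≤ r ∧ ∀ s ∈ Ioc 0 ε,
      α * s ^ e + β * s ^ (e + k) < ((c - M * s) ^ 2)⁻¹ := by
    have hε'' : (0 : ℝ) < ε' := hε'
    exact ⟨min r (ε' / 2), lt_min hr.1 (by linarith), min_le_left _ _, fun s hs =>
      hsub ⟨hs.1, by linarith [hs.2.trans (min_le_right _ _)]⟩⟩
  have hφ : ∀ s ∈ Ioc 0 q, 0 < α * s ^ e + β * s ^ (e + k) := fun s hs =>
    twoPowers_pos hα hβ hs.1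
  obtain ⟨p₁, p₂, h1, h2, h3, hp1, hp2, hp3⟩ := exists_sign_pattern_of_convexOn_concaveOn hεr hr.2
    (continuousOn_twoPowers_rpow_sub (e := e) (k := k) (c := c) (M := M) hα hβ hε0)
    ((convexOn_twoPowers_rpow hα hβ hε0 fun s hs => hr1 s ⟨hε0.trans_le hs.1, hs.2⟩).sub
      (concaveOn_affine c M (convex_Icc _ _)))
    ((concaveOn_twoPowers_rpow hα hβ hr.1 hr2).sub (convexOn_affine c M (convex_Icc _ _)))
    ((rpow_neg_half_sub_nonneg_iff (hφ q ⟨hq, le_rfl⟩) (hL q ⟨hq.le, le_rfl⟩)).2 hqL)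
  have hnn : ∀ s ∈ Ioc 0 q, 0 ≤ (α * s ^ e + β * s ^ (e + k)) ^ (-(1 / 2) : ℝ) - (c - M * s) →
      α * s ^ e + β * s ^ (e + k) - ((c - M * s) ^ 2)⁻¹ ≤ 0 := fun s hs h =>
    sub_nonpos.2 ((rpow_neg_half_sub_nonneg_iff (hφ s hs) (hL s ⟨hs.1.le, hs.2⟩)).1 h)
  have hnp : ∀ s ∈ Ioc 0 q, (α * s ^ e + β * s ^ (e + k)) ^ (-(1 / 2) : ℝ) - (c - M * s) ≤ 0 →
      0 ≤ α * s ^ e + β * s ^ (e + k) - ((c - M * s) ^ 2)⁻¹ := fun s hs h =>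
    sub_nonneg.2 ((rpow_neg_half_sub_nonpos_iff (hφ s hs) (hL s ⟨hs.1.le, hs.2⟩)).1 h)
  refine integral_nonneg_of_hasDerivAt_sign (hε0.le.trans h1) h2 h3 hc hd
    (fun s hs => ?_)
    (fun s hs => hnp s ⟨(hε0.trans_le h1).trans hs.1, hs.2.le.trans h3⟩ (hp2 s hs))
    (fun s hs => hnn s ⟨(hε0.trans_le (h1.trans h2)).trans hs.1, hs.2.le⟩ (hp3 s hs)) hF0 hFq
    hint ht
  rcases le_or_gt s ε with h | h
  · exact (sub_neg.2 (hεsmall s ⟨hs.1, h⟩)).le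
  · exact hnn s ⟨hs.1, hs.2.le.trans (h2.trans h3)⟩ (hp1 s ⟨h, hs.2⟩)

end TwoPowers

/-! ### The optimality criterion for the Crisanti–Sommers functional -/

namespace OrderParameter

instance (a : OrderParameter) : SFinite a.measure := by
  unfold OrderParameter.measure
  infer_instance

theorem aemeasurable_γ (a : OrderParameter) :
    AEMeasurable a.γ (volume.restrict (Ico (0 : ℝ) 1)) :=
  aemeasurable_restrict_of_monotoneOn measurableSet_Ico a.γ_mono

theorem lintegral_measure (a : OrderParameter) {g : ℝ → ℝ≥0∞} (hg : Measurable g) :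
    ∫⁻ s, g s ∂a.measure =
      (∫⁻ s in Ico (0 : ℝ) 1, ENNReal.ofReal (a.γ s) * g s) + ENNReal.ofReal a.Δ * g 1 := by
  rw [OrderParameter.measure, lintegral_add_measure, lintegral_smul_measure, lintegral_dirac' _ hg,
    lintegral_withDensity_eq_lintegral_mul₀ a.aemeasurable_γ.ennreal_ofReal hg.aemeasurable]
  rfl

theorem measure_apply (a : OrderParameter) {A : Set ℝ} (hA : MeasurableSet A) :
    a.measure A = (∫⁻ s in A ∩ Ico (0 : ℝ) 1, ENNReal.ofReal (a.γ s)) +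
      ENNReal.ofReal a.Δ * A.indicator 1 1 := by
  rw [OrderParameter.measure, Measure.add_apply, Measure.smul_apply, Measure.dirac_apply' _ hA,
    withDensity_apply _ hA, Measure.restrict_restrict hA, smul_eq_mul]

theorem ae_mem_Ioc (a : OrderParameter) : ∀ᵐ s ∂a.measure, s ∈ Ioc (0 : ℝ) 1 := by
  change a.measure (Ioc (0 : ℝ) 1)ᶜ = 0
  rw [a.measure_apply measurableSet_Ioc.compl]
  have h : (Ioc (0 : ℝ) 1)ᶜ ∩ Ico 0 1 ⊆ {0} := fun x hx => by
    by_contra h0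
    exact hx.1 ⟨lt_of_le_of_ne hx.2.1 (Ne.symm h0), hx.2.2.le⟩
  rw [Measure.restrict_eq_zero.2 (measure_mono_null h (by simp))]
  simp

theorem measure_restrict_Icc (a : OrderParameter) : a.measure.restrict (Icc 0 1) = a.measure :=
  Measure.restrict_eq_self_of_ae_mem (a.ae_mem_Ioc.mono fun _ hs => ⟨hs.1.le, hs.2⟩)

theorem measure_Ioi (a : OrderParameter) (r : ℝ) :
    a.measure (Ioi r) = a.measure (Ioc (max r 0) 1) := by
  refine measure_congr ?_
  filter_upwards [a.ae_mem_Ioc] with s hs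
  have : (s ∈ Ioi r) = (s ∈ Ioc (max r 0) 1) := by
    simp [hs.1, hs.2]
  exact this

theorem antitone_measure_Ioc (ν : Measure ℝ) : Antitone fun r => ν (Ioc r 1) :=
  fun _ _ h => measure_mono (Ioc_subset_Ioc_left h)

/-- An order measure is determined by its tails `ν((r,1])` for almost every `r ∈ [0,1]`. -/
theorem measure_eq_of_ae_tail_eq {a a' : OrderParameter} (hfin : a.measure univ ≠ ∞)
    (h : ∀ᵐ r ∂volume.restrict (Icc (0 : ℝ) 1), a.measure (Ioc r 1) = a'.measure (Ioc r 1)) :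
    a.measure = a'.measure := by
  have hd := Measure.dense_of_ae ((ae_restrict_iff' measurableSet_Icc).1 h)
  have hright : ∀ r ∈ Ico (0 : ℝ) 1, a.measure (Ioc r 1) = a'.measure (Ioc r 1) := by
    intro r hr
    obtain ⟨u, hu, hmem, hlim⟩ := hd.exists_seq_strictAnti_tendsto_of_lt hr.2
    have hU : ⋃ n, Ioc (u n) 1 = Ioc r 1 := by
      ext x
      simp only [mem_iUnion, mem_Ioc]
      constructor
      · rintro ⟨n, hn, hx⟩
        exact ⟨(hmem n).1.1.trans hn, hx⟩
      · rintro ⟨hx, hx1⟩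
        obtain ⟨n, hn⟩ := (hlim.eventually (gt_mem_nhds hx)).exists
        exact ⟨n, hn, hx1⟩
    have hm : Monotone fun n => Ioc (u n) (1 : ℝ) := fun m n hmn =>
      Ioc_subset_Ioc_left (hu.antitone hmn)
    have h1 := tendsto_measure_iUnion_atTop (μ := a.measure) hm
    have h2 := tendsto_measure_iUnion_atTop (μ := a'.measure) hm
    rw [hU] at h1 h2
    refine tendsto_nhds_unique h1 (h2.congr fun n => ?_)
    exact ((hmem n).2 ⟨hr.1.trans (hmem n).1.1.le, (hmem n).1.2.le⟩).symm
  have hIoi : ∀ r, a.measure (Ioi r) = a'.measure (Ioi r) := by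
    intro r
    rw [measure_Ioi, measure_Ioi]
    rcases lt_or_ge (max r 0) 1 with h1 | h1
    · exact hright _ ⟨le_max_right _ _, h1⟩
    · simp [Ioc_eq_empty_of_le h1]
  have : IsFiniteMeasure a.measure := ⟨lt_top_iff_ne_top.2 hfin⟩
  refine ext_of_generate_finite _ (borel_eq_generateFrom_Ioi ℝ ▸ BorelSpace.measurable_eq)
    isPiSystem_Ioi ?_ ?_
  · rintro _ ⟨r, rfl⟩
    exact hIoi r
  · have h1 : ∀ b : OrderParameter, b.measure univ = b.measure (Ioi 0) := fun b =>
      (measure_congr (by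
        filter_upwards [b.ae_mem_Ioc] with s hs
        have : (s ∈ Ioi (0 : ℝ)) = (s ∈ univ) := by simp [hs.1]
        exact this)).symm
    rw [h1, h1, hIoi]

/-- Layer-cake comparison: up to null sets the superlevel sets of `γ` are the intervals `[t,1)`,
so it suffices to compare the integrals of the two functions over these. -/
theorem lintegral_γ_mul_le (a : OrderParameter) {f g : ℝ → ℝ≥0∞} (hf : Measurable f)
    (hg : Measurable g)
    (h : ∀ t ∈ Icc (0 : ℝ) 1, ∫⁻ s in Ico t 1, f s ≤ ∫⁻ s in Ico t 1, g s) :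
    ∫⁻ s in Ico (0 : ℝ) 1, ENNReal.ofReal (a.γ s) * f s ≤
      ∫⁻ s in Ico (0 : ℝ) 1, ENNReal.ofReal (a.γ s) * g s := by
  have key : ∀ f : ℝ → ℝ≥0∞, Measurable f →
      ∫⁻ s in Ico (0 : ℝ) 1, ENNReal.ofReal (a.γ s) * f s =
        ∫⁻ t in Ioi 0, ∫⁻ s in {s | t < a.γ s} ∩ Ico 0 1, f s := by
    intro f hf
    have hac := withDensity_absolutelyContinuous (volume.restrict (Ico (0 : ℝ) 1)) f
    have h1 := lintegral_withDensity_eq_lintegral_mul₀ (μ := volume.restrict (Ico (0 : ℝ) 1))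
      hf.aemeasurable a.aemeasurable_γ.ennreal_ofReal
    have h2 := lintegral_eq_lintegral_meas_lt
      ((volume.restrict (Ico (0 : ℝ) 1)).withDensity f) (f := a.γ)
      (hac.ae_le ((ae_restrict_iff' measurableSet_Ico).2 (ae_of_all _ a.γ_nonneg)))
      (a.aemeasurable_γ.mono_ac hac)
    rw [h1] at h2
    simp only [withDensity_apply', Measure.restrict_restrict' measurableSet_Ico] at h2
    rw [← h2]
    simp only [Pi.mul_apply, mul_comm]
  rw [key f hf, key g hg]
  refine lintegral_mono fun l => ?_
  simp only
  set U := {s | l < a.γ s} ∩ Ico 0 1 with hU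
  rcases U.eq_empty_or_nonempty with hemp | hne
  · simp [hemp]
  have hbdd : BddBelow U := ⟨0, fun s hs => hs.2.1⟩
  have hsub1 : Ioo (sInf U) 1 ⊆ U := by
    intro s hs
    obtain ⟨x, hx, hxs⟩ := (csInf_lt_iff hbdd hne).1 hs.1
    have hs' : s ∈ Ico (0 : ℝ) 1 := ⟨hx.2.1.trans hxs.le, hs.2⟩
    exact ⟨lt_of_lt_of_le hx.1 (a.γ_mono hx.2 hs' hxs.le), hs'⟩
  have hsub2 : U ⊆ Ico (sInf U) 1 := fun s hs => ⟨csInf_le hbdd hs, hs.2.2⟩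
  have hae : U =ᵐ[volume] Ico (sInf U) 1 :=
    Filter.EventuallyLE.antisymm hsub2.eventuallyLE
      (Ioo_ae_eq_Ico.symm.le.trans hsub1.eventuallyLE)
  rw [Measure.restrict_congr_set hae]
  obtain ⟨x, hx⟩ := hne
  exact h _ ⟨le_csInf ⟨x, hx⟩ fun s hs => hs.2.1, (csInf_le hbdd hx).trans hx.2.2.le⟩

/-- Tonelli's theorem: `∫ ν((r,1]) w(r) dr = ∫ (∫_0^s w) ν(ds)`. -/
theorem lintegral_tail_mul (a : OrderParameter) {w : ℝ → ℝ≥0∞} (hw : Measurable w) :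
    ∫⁻ r in Icc (0 : ℝ) 1, a.measure (Ioc r 1) * w r =
      ∫⁻ s, (∫⁻ r in Ico 0 s, w r) ∂a.measure := by
  have hmeas : Measurable (Function.uncurry fun r s : ℝ =>
      {p : ℝ × ℝ | p.1 < p.2 ∧ p.2 ≤ 1}.indicator (fun p => w p.1) (r, s)) :=
    (hw.comp measurable_fst).indicator ((measurableSet_lt measurable_fst measurable_snd).inter
      (measurableSet_le measurable_snd measurable_const))
  have h := lintegral_lintegral_swap (μ := volume.restrict (Icc (0 : ℝ) 1)) (ν := a.measure)
    hmeas.aemeasurable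
  calc _ = ∫⁻ r in Icc (0 : ℝ) 1, ∫⁻ s,
        {p : ℝ × ℝ | p.1 < p.2 ∧ p.2 ≤ 1}.indicator (fun p => w p.1) (r, s) ∂a.measure := by
        refine lintegral_congr fun r => ?_
        have : ∀ s, {p : ℝ × ℝ | p.1 < p.2 ∧ p.2 ≤ 1}.indicator (fun p => w p.1) (r, s) =
            (Ioc r 1).indicator (fun _ => w r) s := fun s => by
          simp [indicator]
        simp only [this]
        rw [lintegral_indicator measurableSet_Ioc, setLIntegral_const, mul_comm]
    _ = _ := h
    _ = _ := by
        refine lintegral_congr_ae ?_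
        filter_upwards [a.ae_mem_Ioc] with s hs
        have : ∀ r, {p : ℝ × ℝ | p.1 < p.2 ∧ p.2 ≤ 1}.indicator (fun p => w p.1) (r, s) =
            (Iio s).indicator w r := fun r => by
          simp [indicator, hs.2]
        simp only [this]
        rw [lintegral_indicator measurableSet_Iio, Measure.restrict_restrict measurableSet_Iio]
        congr 2
        ext r
        simp only [mem_inter_iff, mem_Iio, mem_Icc, mem_Ico]
        exact ⟨fun h => ⟨h.2.1, h.1⟩, fun h => ⟨h.2, h.1, h.2.le.trans hs.2⟩⟩

end OrderParameter

/-- The convex function `1 / x` lies above its tangent line at `N`, and touches it only there. The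
extended values `x = 0` and `x = ∞` are covered too, since there the right-hand side is infinite. -/
theorem two_mul_inv_le_inv_add {N : ℝ} (hN : 0 < N) (x : ℝ≥0∞) :
    2 * (ENNReal.ofReal N)⁻¹ ≤ x * ENNReal.ofReal ((N ^ 2)⁻¹) + x⁻¹ ∧
      (x * ENNReal.ofReal ((N ^ 2)⁻¹) + x⁻¹ = 2 * (ENNReal.ofReal N)⁻¹ ↔
        x = ENNReal.ofReal N) := by
  have hc : ENNReal.ofReal ((N ^ 2)⁻¹) ≠ 0 := by
    rw [Ne, ENNReal.ofReal_eq_zero, not_le]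
    positivity
  have hrhs : 2 * (ENNReal.ofReal N)⁻¹ = ENNReal.ofReal (2 * N⁻¹) := by
    rw [ENNReal.ofReal_mul (by norm_num), ENNReal.ofReal_inv_of_pos hN]
    simp
  have htop : ∞ ≠ ENNReal.ofReal (2 * N⁻¹) := ENNReal.ofReal_ne_top.symm
  rcases eq_or_ne x 0 with rfl | h0
  · rw [hrhs]
    refine ⟨by simp, ⟨fun h => absurd h (by rwa [zero_mul, ENNReal.inv_zero, zero_add]),
      fun h => ?_⟩⟩
    rw [eq_comm, ENNReal.ofReal_eq_zero] at h
    linarith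
  rcases eq_or_ne x ∞ with rfl | h1
  · rw [hrhs, ENNReal.top_mul hc]
    exact ⟨by simp, ⟨fun h => absurd h (by rwa [ENNReal.inv_top, add_zero]),
      fun h => absurd h (by simp)⟩⟩
  obtain ⟨y, hy, rfl⟩ : ∃ y : ℝ, 0 < y ∧ x = ENNReal.ofReal y :=
    ⟨x.toReal, ENNReal.toReal_pos h0 h1, (ENNReal.ofReal_toReal h1).symm⟩
  have hlhs : ENNReal.ofReal y * ENNReal.ofReal ((N ^ 2)⁻¹) + (ENNReal.ofReal y)⁻¹ =
      ENNReal.ofReal (y * (N ^ 2)⁻¹ + y⁻¹) := by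
    rw [ENNReal.ofReal_add (by positivity) (by positivity), ENNReal.ofReal_mul hy.le,
      ENNReal.ofReal_inv_of_pos hy]
  have hdiff : y * (N ^ 2)⁻¹ + y⁻¹ - 2 * N⁻¹ = (y - N) ^ 2 / (N ^ 2 * y) := by
    field_simp
    ring
  rw [hlhs, hrhs]
  constructor
  · apply ENNReal.ofReal_le_ofReal
    have : 0 ≤ (y - N) ^ 2 / (N ^ 2 * y) := by positivity
    linarith
  · rw [ENNReal.ofReal_eq_ofReal_iff (by positivity) (by positivity),
      ENNReal.ofReal_eq_ofReal_iff hy.le hN.le, ← sub_eq_zero, hdiff, div_eq_zero_iff,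
      or_iff_left (by positivity), sq_eq_zero_iff, sub_eq_zero]

/-- The order parameter `γ = m₁ 1_{[0,q)} + (m₁ + m₂) 1_{[q,1)}`, with mass `Δ` at `1`. -/
noncomputable def twoStep {m₁ m₂ Δ : ℝ} (h₁ : 0 < m₁) (h₂ : 0 < m₂) (hΔ : 0 < Δ) (q : ℝ) :
    OrderParameter where
  γ s := m₁ + if q ≤ s then m₂ else 0
  Δ := Δ
  γ_nonneg s _ := by split_ifs <;> positivity
  γ_mono s _ t _ hst := by
    simp only
    split_ifs with h h' h'
    · rfl
    · exact absurd (h.trans hst) h'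
    · linarith
    · rfl
  γ_rightCont s _ := by
    by_cases hq : q ≤ s
    · refine (continuousWithinAt_const (b := m₁ + m₂)).congr (fun t ht => ?_) ?_
      · rw [if_pos (hq.trans ht)]
      · rw [if_pos hq]
    · have : ∀ᶠ t in nhdsWithin s (Ici s), m₁ + (if q ≤ t then m₂ else 0) = m₁ + 0 := by
        filter_upwards [nhdsWithin_le_nhds (Iio_mem_nhds (not_le.1 hq))] with t ht
        rw [if_neg (not_le.2 ht)]
      exact (continuousWithinAt_const (b := m₁ + 0)).congr_of_eventuallyEq this (by rw [if_neg hq])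
  Δ_pos := hΔ

/-- The tail `ν((r,1])`, for `r ∈ [0,1)`, of the order measure of `twoStep`. -/
noncomputable def twoStepTail (m₁ m₂ Δ q r : ℝ) : ℝ := Δ + m₁ * (1 - r) + m₂ * (1 - max r q)

section TwoStep

variable {m₁ m₂ Δ q : ℝ} (h₁ : 0 < m₁) (h₂ : 0 < m₂) (hΔ : 0 < Δ)

theorem lintegral_twoStep_measure {g : ℝ → ℝ≥0∞} (hg : Measurable g) (hq : 0 ≤ q) :
    ∫⁻ s, g s ∂(twoStep h₁ h₂ hΔ q).measure =
      ENNReal.ofReal m₁ * (∫⁻ s in Ico (0 : ℝ) 1, g s) +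
        ENNReal.ofReal m₂ * (∫⁻ s in Ico q 1, g s) + ENNReal.ofReal Δ * g 1 := by
  rw [OrderParameter.lintegral_measure _ hg]
  congr 1
  have : ∀ s, ENNReal.ofReal ((twoStep h₁ h₂ hΔ q).γ s) * g s =
      ENNReal.ofReal m₁ * g s + (Ici q).indicator (fun s => ENNReal.ofReal m₂ * g s) s := by
    intro s
    by_cases hs : q ≤ s
    · simp [twoStep, hs, ENNReal.ofReal_add h₁.le h₂.le, add_mul]
    · simp [twoStep, hs]
  simp only [this]
  rw [lintegral_add_left (hg.const_mul _), lintegral_const_mul _ hg,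
    lintegral_indicator measurableSet_Ici, lintegral_const_mul _ hg,
    Measure.restrict_restrict measurableSet_Ici]
  congr 4
  ext s
  simp only [mem_inter_iff, mem_Ici, mem_Ico]
  exact ⟨fun h => ⟨h.1, h.2.2⟩, fun h => ⟨h.1, hq.trans h.1, h.2⟩⟩

theorem twoStep_measure_Ioc (hq : q ∈ Ioo (0 : ℝ) 1) {r : ℝ} (hr : r ∈ Ico (0 : ℝ) 1) :
    (twoStep h₁ h₂ hΔ q).measure (Ioc r 1) = ENNReal.ofReal (twoStepTail m₁ m₂ Δ q r) := by
  rw [← lintegral_indicator_one measurableSet_Ioc, lintegral_twoStep_measure h₁ h₂ hΔ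
    (measurable_one.indicator measurableSet_Ioc) hq.1.le, lintegral_indicator_one measurableSet_Ioc,
    lintegral_indicator_one measurableSet_Ioc, Measure.restrict_apply measurableSet_Ioc,
    Measure.restrict_apply measurableSet_Ioc]
  have hA : Ioc r 1 ∩ Ico 0 1 = Ioo r 1 := by
    ext x
    simp only [mem_inter_iff, mem_Ioc, mem_Ico, mem_Ioo]
    exact ⟨fun h => ⟨h.1.1, h.2.2⟩, fun h => ⟨⟨h.1, h.2.le⟩, hr.1.trans h.1.le, h.2⟩⟩
  have hB : volume (Ioc r 1 ∩ Ico q 1) = ENNReal.ofReal (1 - max r q) := by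
    rcases lt_or_ge r q with h | h
    · have : Ioc r 1 ∩ Ico q 1 = Ico q 1 := inter_eq_right.2 fun x hx =>
        ⟨h.trans_le hx.1, hx.2.le⟩
      rw [this, max_eq_right h.le, Real.volume_Ico]
    · have : Ioc r 1 ∩ Ico q 1 = Ioo r 1 := by
        ext x
        simp only [mem_inter_iff, mem_Ioc, mem_Ico, mem_Ioo]
        exact ⟨fun h => ⟨h.1.1, h.2.2⟩, fun h' => ⟨⟨h'.1, h'.2.le⟩, h.trans h'.1.le, h'.2⟩⟩
      rw [this, max_eq_left h, Real.volume_Ioo]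
  have h1r : 0 ≤ 1 - r := by linarith [hr.2]
  have h1q : 0 ≤ 1 - max r q := by linarith [max_lt hr.2 hq.2]
  rw [hA, hB, Real.volume_Ioo, indicator_of_mem (show (1 : ℝ) ∈ Ioc r 1 from ⟨hr.2, le_rfl⟩),
    ← ENNReal.ofReal_mul h₁.le, ← ENNReal.ofReal_mul h₂.le, Pi.one_apply, mul_one,
    ← ENNReal.ofReal_add (by positivity) (by positivity), ← ENNReal.ofReal_add (by positivity)
    hΔ.le, twoStepTail]
  congr 1
  ring

theorem le_twoStepTail (h₁ : 0 ≤ m₁) (h₂ : 0 ≤ m₂) (hq : q ≤ 1) {r : ℝ} (hr : r ≤ 1) :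
    Δ ≤ twoStepTail m₁ m₂ Δ q r := by
  have h1r : 0 ≤ 1 - r := by linarith
  have h1q : 0 ≤ 1 - max r q := by linarith [max_le hr hq]
  have : 0 ≤ m₁ * (1 - r) + m₂ * (1 - max r q) := by positivity
  unfold twoStepTail
  linarith

theorem continuous_twoStepTail : Continuous (twoStepTail m₁ m₂ Δ q) := by
  unfold twoStepTail
  fun_prop

theorem isInducedMeasure_twoStep (hq : q ∈ Ioo (0 : ℝ) 1) :
    IsInducedMeasure (twoStep h₁ h₂ hΔ q).measure
      (ENNReal.ofReal m₁ • Measure.dirac 0 + ENNReal.ofReal m₂ • Measure.dirac q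
        + ENNReal.ofReal Δ • Measure.dirac 1) := by
  refine ⟨_, rfl, ?_, fun s hs => ?_, ?_⟩
  · simp [hq.1.le, hq.2.le]
  · by_cases h : q ≤ s
    · simp [twoStep, h, hs.1, hs.2, hq.1.le, ENNReal.ofReal_add h₁.le h₂.le]
    · simp [twoStep, h, hs.1, hs.2]
  · simp [twoStep, hq.2.ne]

/-- The order measure of `twoStep` minimises the Crisanti–Sommers functional, and is the only
minimiser, as soon as `ξ'` dominates `W(s) = ∫_0^s dr / ν((r,1])²` in the sense of integrals over
the final segments `[t,1)`, with equality at `1` and for the segments that start at an atom. -/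
theorem isParisiMeasure_twoStep (ξ : Mixture) (hq : q ∈ Ioo (0 : ℝ) 1) {W : ℝ → ℝ}
    (hWm : Measurable W)
    (hW : ∀ s ∈ Icc (0 : ℝ) 1, ∫⁻ r in Ico 0 s, ENNReal.ofReal ((twoStepTail m₁ m₂ Δ q r ^ 2)⁻¹) =
      ENNReal.ofReal (W s))
    (hW1 : W 1 = deriv ξ.eval 1)
    (hle : ∀ t ∈ Icc (0 : ℝ) 1, ∫⁻ s in Ico t 1, ENNReal.ofReal (W s) ≤
      ∫⁻ s in Ico t 1, ENNReal.ofReal (deriv ξ.eval s))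
    (h0 : ∫⁻ s in Ico (0 : ℝ) 1, ENNReal.ofReal (W s) =
      ∫⁻ s in Ico (0 : ℝ) 1, ENNReal.ofReal (deriv ξ.eval s))
    (hqW : ∫⁻ s in Ico q 1, ENNReal.ofReal (W s) =
      ∫⁻ s in Ico q 1, ENNReal.ofReal (deriv ξ.eval s)) :
    ξ.IsParisiMeasure (twoStep h₁ h₂ hΔ q).measure := by
  set N := twoStepTail m₁ m₂ Δ q with hN
  have hNpos : ∀ r ∈ Icc (0 : ℝ) 1, 0 < N r := fun r hr =>
    hΔ.trans_le (le_twoStepTail h₁.le h₂.le hq.2.le hr.2)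
  have hNc : Continuous N := continuous_twoStepTail
  have hfm : Measurable fun s => ENNReal.ofReal (deriv ξ.eval s) :=
    (measurable_deriv _).ennreal_ofReal
  have hwm : Measurable fun r => ENNReal.ofReal ((N r ^ 2)⁻¹) :=
    ((hNc.measurable.pow_const 2).inv).ennreal_ofReal
  have hWm' : Measurable fun s => ENNReal.ofReal (W s) := hWm.ennreal_ofReal
  set C : ℝ≥0∞ := ∫⁻ r in Icc (0 : ℝ) 1, 2 * (ENNReal.ofReal (N r))⁻¹ with hC
  -- Tonelli turns the linearisation of `1 / ν((r,1])` into an integral against `ν`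
  have htonelli : ∀ a : OrderParameter, (∫⁻ s, ENNReal.ofReal (W s) ∂a.measure) +
      ∫⁻ r in Icc (0 : ℝ) 1, (a.measure (Ioc r 1))⁻¹ =
      ∫⁻ r in Icc (0 : ℝ) 1, (a.measure (Ioc r 1) * ENNReal.ofReal ((N r ^ 2)⁻¹) +
        (a.measure (Ioc r 1))⁻¹) := by
    intro a
    have hm : Measurable fun r => a.measure (Ioc r 1) * ENNReal.ofReal ((N r ^ 2)⁻¹) :=
      (OrderParameter.antitone_measure_Ioc _).measurable.mul hwm
    rw [lintegral_add_left hm, a.lintegral_tail_mul hwm]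
    congr 1
    refine lintegral_congr_ae ?_
    filter_upwards [a.ae_mem_Ioc] with s hs
    exact (hW s ⟨hs.1.le, hs.2⟩).symm
  have hQ : ∀ a : OrderParameter, ξ.crisantiSommers a.measure =
      2⁻¹ * ((∫⁻ s, ENNReal.ofReal (deriv ξ.eval s) ∂a.measure) +
        ∫⁻ r in Icc (0 : ℝ) 1, (a.measure (Ioc r 1))⁻¹) := fun a => by
    rw [Mixture.crisantiSommers, a.measure_restrict_Icc]
  have hpt : ∀ a : OrderParameter, ∀ r ∈ Icc (0 : ℝ) 1, 2 * (ENNReal.ofReal (N r))⁻¹ ≤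
      a.measure (Ioc r 1) * ENNReal.ofReal ((N r ^ 2)⁻¹) + (a.measure (Ioc r 1))⁻¹ :=
    fun a r hr => (two_mul_inv_le_inv_add (hNpos r hr) _).1
  have hdom : ∀ a : OrderParameter, ∫⁻ s, ENNReal.ofReal (W s) ∂a.measure ≤
      ∫⁻ s, ENNReal.ofReal (deriv ξ.eval s) ∂a.measure := fun a => by
    rw [a.lintegral_measure hWm', a.lintegral_measure hfm, hW1]
    gcongr ?_ + _
    exact a.lintegral_γ_mul_le hWm' hfm hle
  have hlower : ∀ a : OrderParameter, 2⁻¹ * C ≤ ξ.crisantiSommers a.measure := fun a => by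
    rw [hQ a]
    gcongr
    refine le_trans ?_ (add_le_add_left (hdom a) _)
    rw [htonelli a]
    exact setLIntegral_mono' measurableSet_Icc (hpt a)
  have hval : ξ.crisantiSommers (twoStep h₁ h₂ hΔ q).measure = 2⁻¹ * C := by
    have heq : ∫⁻ s, ENNReal.ofReal (deriv ξ.eval s) ∂(twoStep h₁ h₂ hΔ q).measure =
        ∫⁻ s, ENNReal.ofReal (W s) ∂(twoStep h₁ h₂ hΔ q).measure := by
      rw [lintegral_twoStep_measure h₁ h₂ hΔ hfm hq.1.le,
        lintegral_twoStep_measure h₁ h₂ hΔ hWm' hq.1.le, h0, hqW, hW1]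
    rw [hQ, heq, htonelli, hC, setLIntegral_congr Ico_ae_eq_Icc.symm,
      setLIntegral_congr (f := fun r => 2 * _) Ico_ae_eq_Icc.symm]
    congr 1
    refine setLIntegral_congr_fun measurableSet_Ico fun r hr => ?_
    exact (two_mul_inv_le_inv_add (hNpos r ⟨hr.1, hr.2.le⟩) _).2.2
      (twoStep_measure_Ioc h₁ h₂ hΔ hq hr)
  have hCfin : C ≠ ∞ := by
    refine ne_top_of_le_ne_top (b := ∫⁻ _ in Icc (0 : ℝ) 1, 2 * (ENNReal.ofReal Δ)⁻¹) ?_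
      (setLIntegral_mono' measurableSet_Icc fun r hr => ?_)
    · have : ENNReal.ofReal Δ ≠ 0 := by simpa using hΔ
      simpa using ENNReal.mul_ne_top (by simp) (ENNReal.inv_ne_top.2 this)
    · gcongr
      exact le_twoStepTail h₁.le h₂.le hq.2.le hr.2
  have hmin : IsMinOn ξ.crisantiSommers orderMeasures (twoStep h₁ h₂ hΔ q).measure := by
    rintro _ ⟨a, rfl⟩
    exact hval.trans_le (hlower a)
  refine ⟨⟨⟨_, rfl⟩, hmin⟩, ?_⟩
  rintro _ ⟨a, rfl⟩ ha
  have hQa : ξ.crisantiSommers a.measure ≤ 2⁻¹ * C := (ha ⟨_, rfl⟩).trans_eq hval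
  have hle' : ∫⁻ r in Icc (0 : ℝ) 1, (a.measure (Ioc r 1) * ENNReal.ofReal ((N r ^ 2)⁻¹) +
      (a.measure (Ioc r 1))⁻¹) ≤ C := by
    rw [← htonelli a]
    rw [hQ a, ENNReal.mul_le_mul_iff_right (by simp) (by simp)] at hQa
    exact (add_le_add_left (hdom a) _).trans hQa
  have hmeas := (OrderParameter.antitone_measure_Ioc a.measure).measurable
  have hae := ae_eq_of_ae_le_of_lintegral_le
    ((ae_restrict_iff' measurableSet_Icc).2 (ae_of_all _ (hpt a))) hCfin
    ((hmeas.mul hwm).add hmeas.inv).aemeasurable hle'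
  refine (OrderParameter.measure_eq_of_ae_tail_eq ?_ ?_).symm
  · rw [← setLIntegral_one, Measure.restrict_univ,
      lintegral_twoStep_measure h₁ h₂ hΔ measurable_const hq.1.le]
    simp [ENNReal.mul_eq_top]
  · have hne : ∀ᵐ r ∂volume.restrict (Icc (0 : ℝ) 1), r ≠ 1 :=
      ae_restrict_of_ae (by simp [ae_iff])
    filter_upwards [hae, hne, ae_restrict_mem measurableSet_Icc] with r hr hr1 hrI
    rw [twoStep_measure_Ioc h₁ h₂ hΔ hq ⟨hrI.1, lt_of_le_of_ne hrI.2 hr1⟩]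
    exact ((two_mul_inv_le_inv_add (hNpos r hrI) _).2.1 hr.symm).symm

end TwoStep

/-- On an interval where `μ([0,s])` is constant, the density `γ` of `ν` is that constant. -/
theorem IsInducedMeasure.measure_Ioo {ν μ : Measure ℝ} (h : IsInducedMeasure ν μ) {u v : ℝ}
    (hu : 0 ≤ u) (hv : v ≤ 1) {c : ℝ≥0∞} (hc : ∀ s ∈ Ioo u v, μ (Icc 0 s) = c) :
    ν (Ioo u v) = c * ENNReal.ofReal (v - u) := by
  obtain ⟨a, rfl, -, hγ, -⟩ := h
  have hsub : Ioo u v ⊆ Ico 0 1 := fun s hs => ⟨hu.trans hs.1.le, hs.2.trans_le hv⟩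
  rw [a.measure_apply measurableSet_Ioo, inter_eq_left.2 hsub,
    indicator_of_notMem (fun h => absurd (hsub h).2 (lt_irrefl _)), mul_zero, add_zero,
    setLIntegral_congr_fun (g := fun _ => c) measurableSet_Ioo
      fun s hs => (hγ s (hsub hs)).symm.trans (hc s hs), setLIntegral_const, Real.volume_Ioo]

/-- Two atoms, one of them at `1`, leave `γ` either constant on `(0,1)` or zero near `0`; an order
parameter with atoms at `0`, `q` and `1` is neither. -/
theorem Mixture.HasThreeAtoms.not_isRSB_one {ξ : Mixture} (h : ξ.HasThreeAtoms) : ¬ ξ.IsRSB 1 := by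
  rintro ⟨ν', hν', S, m, hcard, hm, hind'⟩
  obtain ⟨ν, hν, m₁, m₂, Δ, q, h₁, h₂, hΔ, hq, hind⟩ := h
  obtain rfl : ν' = ν := hν.2 ν' hν'.1.1 hν'.1.2
  have hm₁ : ENNReal.ofReal m₁ ≠ 0 := by simpa using h₁
  have hm₂ : ENNReal.ofReal m₂ ≠ 0 := by simpa using h₂
  -- the order parameter takes two different values, to the left and to the right of `q`
  have hleft : ∀ v ∈ Ioc 0 q, ν' (Ioo 0 v) = ENNReal.ofReal m₁ * ENNReal.ofReal (v - 0) :=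
    fun v hv => hind.measure_Ioo le_rfl (hv.2.trans hq.2.le) fun s hs => by
      have h1 : s < q := hs.2.trans_le hv.2
      have h2 : s < 1 := h1.trans hq.2
      simp [hs.1.le, h1, h2]
  have hright : ν' (Ioo q 1) = (ENNReal.ofReal m₁ + ENNReal.ofReal m₂) * ENNReal.ofReal (1 - q) :=
    hind.measure_Ioo hq.1.le le_rfl fun s hs => by
      have h1 : 0 ≤ s := (hq.1.trans hs.1).le
      simp [h1, hs.1.le, hs.2, hq.1.le]
  have hS : ∀ x ∈ S, x ∈ Icc (0 : ℝ) 1 := by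
    intro x hx
    by_contra hxI
    obtain ⟨a, -, h0, -, -⟩ := hind'
    rw [Measure.finsetSum_apply, Finset.sum_eq_zero_iff] at h0
    have := h0 x hx
    rw [Measure.smul_apply, Measure.dirac_apply_of_mem hxI] at this
    simp only [smul_eq_mul, mul_one, ENNReal.ofReal_eq_zero] at this
    exact absurd (hm x hx) (not_lt.2 this)
  have h1S : (1 : ℝ) ∈ S := by
    by_contra h1
    obtain ⟨a, -, -, -, h0⟩ := hind'
    rw [Measure.finsetSum_apply, Finset.sum_eq_zero] at h0
    · rw [eq_comm, ENNReal.ofReal_eq_zero] at h0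
      exact absurd a.Δ_pos (not_lt.2 h0)
    · intro x hx
      have : x ≠ 1 := fun h => h1 (h ▸ hx)
      simp [this]
  obtain ⟨x, hx1, hSx⟩ : ∃ x, x ≠ 1 ∧ S = {x, 1} := by
    obtain ⟨x, y, hxy, rfl⟩ := Finset.card_eq_two.1 hcard
    simp only [Finset.mem_insert, Finset.mem_singleton] at h1S
    rcases h1S with rfl | rfl
    · exact ⟨y, hxy.symm, Finset.pair_comm _ _⟩
    · exact ⟨x, hxy, rfl⟩
  have hx := hS x (by simp [hSx])
  subst hSx
  rw [Finset.sum_pair hx1] at hind'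
  rcases hx.1.lt_or_eq with h0 | rfl
  · have h3 : 0 < min x q := lt_min h0 hq.1
    have h4 := hleft (min x q) ⟨h3, min_le_right _ _⟩
    rw [hind'.measure_Ioo (c := 0) le_rfl ((min_le_right _ _).trans hq.2.le) fun s hs => by
      have h5 : s < x := hs.2.trans_le (min_le_left _ _)
      have h6 : s < 1 := h5.trans_le hx.2
      simp [h5, h6], zero_mul, eq_comm, mul_eq_zero, or_iff_right hm₁, sub_zero,
      ENNReal.ofReal_eq_zero] at h4
    exact absurd h3 (not_lt.2 h4)
  · have hc : ∀ s ∈ Ico (0 : ℝ) 1, (ENNReal.ofReal (m 0) • Measure.dirac (0 : ℝ) +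
        ENNReal.ofReal (m 1) • Measure.dirac (1 : ℝ)) (Icc 0 s) = ENNReal.ofReal (m 0) := by
      intro s hs
      simp [hs.1, hs.2]
    have h3 := hleft q ⟨hq.1, le_rfl⟩
    rw [hind'.measure_Ioo le_rfl hq.2.le fun s hs => hc s ⟨hs.1.le, hs.2.trans hq.2⟩,
      ENNReal.mul_left_inj (by simpa using hq.1) (by simp)] at h3
    rw [hind'.measure_Ioo hq.1.le le_rfl fun s hs => hc s ⟨(hq.1.trans hs.1).le, hs.2⟩,
      ENNReal.mul_left_inj (by simpa using hq.2) (by simp), h3] at hright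
    exact hm₂ ((ENNReal.add_right_inj ENNReal.ofReal_ne_top).1
      (hright.symm.trans (add_zero _).symm))

/-! ### Sufficient conditions for three atoms, for a mixture of two powers -/

/-- The function `a s ^ p + b s ^ (p + k)` with `p = e + 2`; writing the lower exponent as `e + 2`
keeps the exponents of its first two derivatives free of subtraction. -/
noncomputable def twoPow (a b : ℝ) (e k : ℕ) (s : ℝ) : ℝ := a * s ^ (e + 2) + b * s ^ (e + k + 2)

/-- The derivative of `twoPow`. -/
noncomputable def twoPowDeriv (a b : ℝ) (e k : ℕ) (s : ℝ) : ℝ :=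
  (e + 2) * a * s ^ (e + 1) + (e + k + 2) * b * s ^ (e + k + 1)

/-- The second derivative of `twoPow`. -/
noncomputable def twoPowDeriv2 (a b : ℝ) (e k : ℕ) (s : ℝ) : ℝ :=
  (e + 2) * (e + 1) * a * s ^ e + (e + k + 2) * (e + k + 1) * b * s ^ (e + k)

section

variable {a b : ℝ} {e k : ℕ}

theorem hasDerivAt_twoPow (s : ℝ) :
    HasDerivAt (twoPow a b e k) (twoPowDeriv a b e k s) s := by
  refine (((hasDerivAt_pow (e + 2) s).const_mul a).add
    ((hasDerivAt_pow (e + k + 2) s).const_mul b)).congr_deriv ?_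
  simp only [twoPowDeriv, show e + 2 - 1 = e + 1 from rfl,
    show e + k + 2 - 1 = e + k + 1 from rfl]
  push_cast
  ring

theorem hasDerivAt_twoPowDeriv (s : ℝ) :
    HasDerivAt (twoPowDeriv a b e k) (twoPowDeriv2 a b e k s) s := by
  refine (((hasDerivAt_pow (e + 1) s).const_mul ((e + 2) * a)).add
    ((hasDerivAt_pow (e + k + 1) s).const_mul ((e + k + 2) * b))).congr_deriv ?_
  simp only [twoPowDeriv2, Nat.add_sub_cancel]
  push_cast
  ring

theorem continuous_twoPowDeriv : Continuous (twoPowDeriv a b e k) := by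
  unfold twoPowDeriv
  fun_prop

theorem continuous_twoPow : Continuous (twoPow a b e k) := by
  unfold twoPow
  fun_prop

theorem integral_twoPowDeriv (u v : ℝ) :
    ∫ s in u..v, twoPowDeriv a b e k s = twoPow a b e k v - twoPow a b e k u :=
  intervalIntegral.integral_eq_sub_of_hasDerivAt (fun s _ => hasDerivAt_twoPow s)
    (continuous_twoPowDeriv.intervalIntegrable _ _)

theorem twoPowDeriv_nonneg (ha : 0 ≤ a) (hb : 0 ≤ b) {s : ℝ} (hs : 0 ≤ s) :
    0 ≤ twoPowDeriv a b e k s := by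
  unfold twoPowDeriv
  positivity

theorem twoPowDeriv_pos (ha : 0 < a) (hb : 0 < b) {s : ℝ} (hs : 0 < s) :
    0 < twoPowDeriv a b e k s := by
  unfold twoPowDeriv
  positivity

theorem twoPowDeriv_mono (ha : 0 < a) (hb : 0 < b) {s t : ℝ} (hs : 0 ≤ s) (hst : s ≤ t) :
    twoPowDeriv a b e k s ≤ twoPowDeriv a b e k t := by
  unfold twoPowDeriv
  gcongr

theorem twoPowDeriv_lt (ha : 0 < a) (hb : 0 < b) {s t : ℝ} (hs : 0 ≤ s) (hst : s < t) :
    twoPowDeriv a b e k s < twoPowDeriv a b e k t := by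
  unfold twoPowDeriv
  gcongr

end

theorem setLIntegral_Ico_ofReal {g : ℝ → ℝ} (hg : Continuous g) {u v : ℝ} (huv : u ≤ v)
    (h : ∀ s ∈ Ico u v, 0 ≤ g s) :
    ∫⁻ s in Ico u v, ENNReal.ofReal (g s) = ENNReal.ofReal (∫ s in u..v, g s) := by
  rw [intervalIntegral.integral_of_le huv, ← setIntegral_congr_set Ico_ae_eq_Ioc,
    ofReal_integral_eq_lintegral_ofReal]
  · exact (hg.integrableOn_Icc (a := u) (b := v)).mono_set Ico_subset_Icc_self
  · exact (ae_restrict_iff' measurableSet_Ico).2 (ae_of_all _ h)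

/-- The optimality conditions. If the tail `N` of the order measure takes the values `A`, `B`, `Δ`
at `0`, `q`, `1`, then `x = A / B` and `X = B / Δ`, and the conditions express that
`F = ξ' - ∫_0^· N⁻²` vanishes at `q` and `1` and has integral zero over `[0,q]` and `[q,1]`, that
`F' q ≤ 0`, that `(ξ'')^(-1/2)` is concave near `q`, and that the atom at `q` has positive mass. -/
structure OptimalityConditions (a b : ℝ) (e k : ℕ) (q x X : ℝ) : Prop where
  q_mem : q ∈ Ioo (0 : ℝ) 1
  one_lt_x : 1 < x
  one_lt_X : 1 < X
  ratio : X * ((1 - q) * twoPowDeriv a b e k q * x) =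
    q * (twoPowDeriv a b e k 1 - twoPowDeriv a b e k q)
  left : twoPow a b e k q = q * twoPowDeriv a b e k q * logRatio x
  right : twoPow a b e k 1 - twoPow a b e k q = (1 - q) * twoPowDeriv a b e k q +
    (1 - q) * (twoPowDeriv a b e k 1 - twoPowDeriv a b e k q) * logRatio X
  deriv2_le : q * twoPowDeriv2 a b e k q ≤ x * twoPowDeriv a b e k q
  curvature_neg : curvature e (e + k)
    ((e + k + 2) * (e + k + 1) * b / ((e + 2) * (e + 1) * a) * q ^ k) < 0
  mass : (x - 1) / q < (1 - 1 / X) / (1 - q)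

/-- The tail `N` is affine on `[0,q]` and on `[q,1]`. The conditions make `F` vanish at `0`, `q` and
`1`, with integral zero in between, so that the convexity of `(ξ'')^(-1/2)` determines the sign of
all integrals of `F` over final segments. -/
theorem OptimalityConditions.hasThreeAtoms {a b : ℝ} {e k : ℕ} {q x X : ℝ}
    (H : OptimalityConditions a b e k q x X) (ha : 0 < a) (hb : 0 < b) (he : e ≠ 0) (hk : k ≠ 0)
    {ξ : Mixture} (hξ : ∀ s, ξ.eval s = twoPow a b e k s) : ξ.HasThreeAtoms := by
  obtain ⟨⟨hq0, hq1⟩, hx, hX, hratio, hleft, hright, hF2, hcurv, hmass⟩ := H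
  have hξd : deriv ξ.eval = twoPowDeriv a b e k := by
    rw [funext hξ]
    exact funext fun s => (hasDerivAt_twoPow s).deriv
  set f := twoPowDeriv a b e k with hf
  have hfq : 0 < f q := twoPowDeriv_pos ha hb hq0
  have hf1 : 0 < f 1 - f q := sub_pos.2 (twoPowDeriv_lt ha hb hq0.le hq1)
  have hf0 : f 0 = 0 := by simp [hf, twoPowDeriv]
  have h1q : 0 < 1 - q := sub_pos.2 hq1
  have hX0 : 0 < X := by linarith
  have hx0 : 0 < x := by linarith
  have hvar : 0 < (1 - q) / (X * (f 1 - f q)) := by positivity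
  obtain ⟨Δ, hΔ, hΔ2⟩ : ∃ Δ : ℝ, 0 < Δ ∧ Δ ^ 2 = (1 - q) / (X * (f 1 - f q)) :=
    ⟨_, Real.sqrt_pos.2 hvar, Real.sq_sqrt hvar.le⟩
  obtain ⟨B, hB⟩ : ∃ B, B = Δ * X := ⟨_, rfl⟩
  obtain ⟨A, hA⟩ : ∃ A, A = B * x := ⟨_, rfl⟩
  have hB0 : 0 < B := by rw [hB]; positivity
  have hA0 : 0 < A := by rw [hA]; positivity
  have hBΔ : (1 - q) / (B * Δ) = f 1 - f q := by
    rw [hB, show Δ * X * Δ = X * Δ ^ 2 by ring, hΔ2]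
    field_simp
  have hAB : q / (A * B) = f q := by
    rw [hA, hB, show Δ * X * x * (Δ * X) = x * X ^ 2 * Δ ^ 2 by ring, hΔ2]
    field_simp
    linarith
  have hB2 : (B ^ 2)⁻¹ = x * f q / q := by
    rw [← hAB, hA]
    field_simp
  obtain ⟨m₁, hm₁⟩ : ∃ m₁, m₁ = (A - B) / q := ⟨_, rfl⟩
  obtain ⟨M, hM⟩ : ∃ M, M = (B - Δ) / (1 - q) := ⟨_, rfl⟩
  have hm₁0 : 0 < m₁ := by
    rw [hm₁, hA, show B * x - B = B * (x - 1) by ring]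
    have : 0 < x - 1 := by linarith
    positivity
  have hMm : m₁ < M := by
    have h1 : m₁ = B * ((x - 1) / q) := by rw [hm₁, hA]; ring
    have h2 : M = B * ((1 - 1 / X) / (1 - q)) := by
      rw [hM, hB]
      field_simp
    rw [h1, h2]
    gcongr
  have hM0 : 0 < M := hm₁0.trans hMm
  have hm₂0 : 0 < M - m₁ := sub_pos.2 hMm
  set N := twoStepTail m₁ (M - m₁) Δ q with hN
  have hmq : m₁ * q = A - B := by rw [hm₁]; field_simp
  have hMq : M * (1 - q) = B - Δ := by rw [hM]; field_simp
  have hNl : ∀ r ≤ q, N r = A - m₁ * r := fun r hr => by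
    rw [hN, twoStepTail, max_eq_right hr]
    linarith
  have hNr : ∀ r, q ≤ r → N r = Δ + M - M * r := fun r hr => by
    rw [hN, twoStepTail, max_eq_left hr]
    ring
  have hNle : ∀ r ≤ 1, Δ ≤ N r := fun r hr => le_twoStepTail hm₁0.le hm₂0.le hq1.le hr
  have hLl : ∀ s ∈ Icc 0 q, 0 < A - m₁ * s := fun s hs => by
    rw [← hNl s hs.2]
    exact hΔ.trans_le (hNle s (hs.2.trans hq1.le))
  have hLr : ∀ s ∈ Icc q 1, 0 < Δ + M - M * s := fun s hs => by
    rw [← hNr s hs.1]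
    exact hΔ.trans_le (hNle s hs.2)
  have hLq : A - m₁ * q = B := by linarith
  have hLq' : Δ + M - M * q = B := by linarith
  -- the maximum with `Δ` is inactive on `(-∞, 1]`, and makes `w` continuous on the whole line
  set w : ℝ → ℝ := fun r => ((max Δ (N r)) ^ 2)⁻¹ with hw
  have hwc : Continuous w := by
    have hNc : Continuous N := continuous_twoStepTail
    refine Continuous.inv₀ (by fun_prop) fun r => ?_
    have : 0 < max Δ (N r) := lt_max_of_lt_left hΔ
    positivity
  have hwN : ∀ r ≤ 1, w r = (N r ^ 2)⁻¹ := fun r hr => by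
    simp only [hw, max_eq_right (hNle r hr)]
  have hw0 : ∀ r, 0 ≤ w r := fun r => by positivity
  set W : ℝ → ℝ := fun s => ∫ r in (0 : ℝ)..s, w r with hWdef
  have hWd : ∀ s, HasDerivAt W (w s) s := fun s => hwc.integral_hasStrictDerivAt 0 s |>.hasDerivAt
  have hWc : Continuous W := continuous_iff_continuousAt.2 fun s => (hWd s).continuousAt
  have hWl : ∀ s ∈ Icc 0 q, W s = (s - 0) / ((A - m₁ * 0) * (A - m₁ * s)) := fun s hs => by
    rw [← integral_inv_sq_affine hs.1 fun r hr => hLl r ⟨hr.1, hr.2.trans hs.2⟩]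
    refine intervalIntegral.integral_congr fun r hr => ?_
    rw [uIcc_of_le hs.1] at hr
    simp only [hwN r (hr.2.trans (hs.2.trans hq1.le)), hNl r (hr.2.trans hs.2)]
  have hWq : W q = f q := by
    rw [hWl q ⟨hq0.le, le_rfl⟩, hLq, ← hAB]
    simp
  have hWr : ∀ s ∈ Icc q 1,
      W s = f q + (s - q) / ((Δ + M - M * q) * (Δ + M - M * s)) := fun s hs => by
    rw [← integral_inv_sq_affine hs.1 fun r hr => hLr r ⟨hr.1, hr.2.trans hs.2⟩, ← hWq]
    rw [hWdef]
    simp only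
    rw [← intervalIntegral.integral_add_adjacent_intervals (hwc.intervalIntegrable 0 q)
      (hwc.intervalIntegrable q s)]
    congr 1
    refine intervalIntegral.integral_congr fun r hr => ?_
    rw [uIcc_of_le hs.1] at hr
    simp only [hwN r (hr.2.trans hs.2), hNr r hr.1]
  have hW1 : W 1 = f 1 := by
    rw [hWr 1 ⟨hq1.le, le_rfl⟩, hLq', show Δ + M - M * 1 = Δ by ring, hBΔ]
    ring
  have hWnn : ∀ s, 0 ≤ s → 0 ≤ W s := fun s hs =>
    intervalIntegral.integral_nonneg hs fun r _ => hw0 r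
  have hfc : Continuous f := continuous_twoPowDeriv
  set F : ℝ → ℝ := fun s => f s - W s with hFdef
  have hFc : Continuous F := hfc.sub hWc
  have hFd : ∀ s, HasDerivAt F (twoPowDeriv2 a b e k s - w s) s := fun s =>
    (hasDerivAt_twoPowDeriv s).sub (hWd s)
  have hFsub : ∀ u v, ∫ s in u..v, F s = (∫ s in u..v, f s) - ∫ s in u..v, W s := fun u v =>
    intervalIntegral.integral_sub (hfc.intervalIntegrable _ _) (hWc.intervalIntegrable _ _)
  have hIl : ∫ s in (0 : ℝ)..q, F s = 0 := by
    have h1 : ∫ s in (0 : ℝ)..q, W s = q * f q * logRatio x := by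
      rw [intervalIntegral.integral_congr (g := fun s => (s - 0) / ((A - m₁ * 0) * (A - m₁ * s)))
        fun s hs => hWl s (by rwa [uIcc_of_le hq0.le] at hs),
        integral_integral_inv_sq_affine hq0 hm₁0 hLl, hLq, ← hAB]
      have : (A - m₁ * 0) / B = x := by rw [hA]; field_simp; simp
      rw [this]
      simp
    rw [hFsub, h1, integral_twoPowDeriv, hleft]
    simp [twoPow]
  have hIr : ∫ s in q..1, F s = 0 := by
    have h1 : ∫ s in q..1, W s = (1 - q) * f q + (1 - q) * (f 1 - f q) * logRatio X := by
      rw [intervalIntegral.integral_congr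
        (g := fun s => f q + (s - q) / ((Δ + M - M * q) * (Δ + M - M * s)))
        fun s hs => hWr s (by rwa [uIcc_of_le hq1.le] at hs), intervalIntegral.integral_add
          (by simp), integral_integral_inv_sq_affine hq1 hM0 hLr, hLq',
        show Δ + M - M * 1 = Δ by ring, hBΔ]
      · have : B / Δ = X := by rw [hB]; field_simp
        rw [this]
        simp
      · apply ContinuousOn.intervalIntegrable
        rw [uIcc_of_le hq1.le]
        intro s hs
        have h1 := hLr s hs
        have h2 := hLr q ⟨le_rfl, hq1.le⟩
        apply ContinuousAt.continuousWithinAt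
        fun_prop (disch := positivity)
    rw [hFsub, h1, integral_twoPowDeriv, hright]
    ring
  have hα : 0 < (e + 2) * (e + 1) * a := by positivity
  have hβ : 0 < (e + k + 2) * (e + k + 1) * b := by positivity
  have hF2' : twoPowDeriv2 a b e k q ≤ (B ^ 2)⁻¹ := by
    rw [hB2, le_div_iff₀ hq0]
    linarith
  have hgr : ∀ t ∈ Icc q 1, 0 ≤ ∫ s in t..1, F s := fun t ht =>
    integral_nonneg_right hα hβ hk hq0 hq1.le hcurv hLr (by rw [hLq']; exact hF2')
      hFc.continuousOn (fun s hs => (hFd s).congr_deriv (by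
        rw [hwN s hs.2.le, hNr s hs.1.le]
        rfl)) (by simp [hFdef, hWq]) (by simp [hFdef, hW1]) hIr ht
  have hgl : ∀ t ∈ Icc 0 q, 0 ≤ ∫ s in t..q, F s := fun t ht =>
    integral_nonneg_left hα hβ hk he hq0 hcurv hLl (by rw [hLq]; exact hF2')
      hFc.continuousOn (fun s hs => (hFd s).congr_deriv (by
        rw [hwN s (hs.2.le.trans hq1.le), hNl s hs.2.le]
        rfl)) (by simp [hFdef, hWdef, hf0]) (by simp [hFdef, hWq]) hIl ht
  have hsplit : ∀ t, ∫ s in t..1, F s = (∫ s in t..q, F s) + ∫ s in q..1, F s := fun t =>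
    (intervalIntegral.integral_add_adjacent_intervals (hFc.intervalIntegrable _ _)
      (hFc.intervalIntegrable _ _)).symm
  have hg : ∀ t ∈ Icc (0 : ℝ) 1, 0 ≤ ∫ s in t..1, F s := fun t ht => by
    rcases le_total q t with h | h
    · exact hgr t ⟨h, ht.2⟩
    · rw [hsplit, hIr, add_zero]
      exact hgl t ⟨ht.1, h⟩
  have hfl : ∀ t ∈ Icc (0 : ℝ) 1, ∫⁻ s in Ico t 1, ENNReal.ofReal (deriv ξ.eval s) =
      ENNReal.ofReal (∫ s in t..1, f s) := fun t ht => by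
    rw [hξd]
    exact setLIntegral_Ico_ofReal hfc ht.2 fun s hs =>
      twoPowDeriv_nonneg ha.le hb.le (ht.1.trans hs.1)
  have hWlint : ∀ t ∈ Icc (0 : ℝ) 1, ∫⁻ s in Ico t 1, ENNReal.ofReal (W s) =
      ENNReal.ofReal (∫ s in t..1, W s) := fun t ht =>
    setLIntegral_Ico_ofReal hWc ht.2 fun s hs => hWnn s (ht.1.trans hs.1)
  have h0mem : (0 : ℝ) ∈ Icc (0 : ℝ) 1 := ⟨le_rfl, zero_le_one⟩
  have hqmem : q ∈ Icc (0 : ℝ) 1 := ⟨hq0.le, hq1.le⟩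
  refine ⟨_, isParisiMeasure_twoStep hm₁0 hm₂0 hΔ ξ ⟨hq0, hq1⟩ (W := W) hWc.measurable
    (fun s hs => ?_) ?_ (fun t ht => ?_) ?_ ?_, m₁, M - m₁, Δ, q, hm₁0, hm₂0, hΔ, ⟨hq0, hq1⟩,
    isInducedMeasure_twoStep hm₁0 hm₂0 hΔ ⟨hq0, hq1⟩⟩
  · rw [← setLIntegral_Ico_ofReal hwc hs.1 fun r _ => hw0 r]
    refine setLIntegral_congr_fun measurableSet_Ico fun r hr => ?_
    simp only [hwN r (hr.2.le.trans hs.2), hN]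
  · rw [hW1, hξd]
  · rw [hfl t ht, hWlint t ht]
    apply ENNReal.ofReal_le_ofReal
    have := hg t ht
    rw [hFsub] at this
    linarith
  · rw [hfl 0 h0mem, hWlint 0 h0mem]
    congr 1
    have := hFsub 0 1
    rw [hsplit, hIl, hIr] at this
    linarith
  · rw [hfl q hqmem, hWlint q hqmem]
    congr 1
    have := hFsub q 1
    rw [hIr] at this
    linarith

/-! ### Solving the optimality conditions -/

section

variable {a b : ℝ} {e k : ℕ}

theorem twoPow_le_twoPowDeriv_mul_iff {q t : ℝ} (hq : 0 < q) :
    twoPow a b e k q ≤ q * twoPowDeriv a b e k q * t ↔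
      a * (1 - (e + 2) * t) ≤ b * q ^ k * ((e + k + 2) * t - 1) := by
  have h : q * twoPowDeriv a b e k q * t - twoPow a b e k q =
      q ^ (e + 2) * (b * q ^ k * ((e + k + 2) * t - 1) - a * (1 - (e + 2) * t)) := by
    simp only [twoPow, twoPowDeriv, pow_add]
    ring
  rw [← sub_nonneg, h, mul_nonneg_iff_of_pos_left (by positivity), sub_nonneg]

theorem twoPowDeriv_mul_le_twoPow_iff {q t : ℝ} (hq : 0 < q) :
    q * twoPowDeriv a b e k q * t ≤ twoPow a b e k q ↔
      b * q ^ k * ((e + k + 2) * t - 1) ≤ a * (1 - (e + 2) * t) := by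
  have h : twoPow a b e k q - q * twoPowDeriv a b e k q * t =
      q ^ (e + 2) * (a * (1 - (e + 2) * t) - b * q ^ k * ((e + k + 2) * t - 1)) := by
    simp only [twoPow, twoPowDeriv, pow_add]
    ring
  rw [← sub_nonneg, h, mul_nonneg_iff_of_pos_left (by positivity), sub_nonneg]

/-- The inequality `s ξ''(s) ≤ x ξ'(s)` is affine in `s ^ k` after division by `s ^ (e + 1)`, and
holds at `s = 0` if `e + 1 ≤ x`; so it passes from `q'` to smaller arguments. -/
theorem deriv2_le_of_le (ha : 0 < a) {q q' x x' : ℝ} (hq : 0 < q)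
    (hqq' : q ≤ q') (hb : 0 < b) (hx' : (e : ℝ) + 1 ≤ x') (hxx' : x' ≤ x)
    (h : q' * twoPowDeriv2 a b e k q' ≤ x' * twoPowDeriv a b e k q') :
    q * twoPowDeriv2 a b e k q ≤ x * twoPowDeriv a b e k q := by
  have key : ∀ s : ℝ, x' * twoPowDeriv a b e k s - s * twoPowDeriv2 a b e k s = s ^ (e + 1) *
      ((e + 2) * a * (x' - (e + 1)) + (e + k + 2) * b * s ^ k * (x' - (e + k + 1))) := by
    intro s
    simp only [twoPowDeriv, twoPowDeriv2, pow_add]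
    ring
  have hq' : 0 < q' := hq.trans_le hqq'
  rw [← sub_nonneg, key, mul_nonneg_iff_of_pos_left (by positivity)] at h
  have h1 : x' * twoPowDeriv a b e k q ≤ x * twoPowDeriv a b e k q :=
    mul_le_mul_of_nonneg_right hxx' (twoPowDeriv_pos ha hb hq).le
  refine le_trans (sub_nonneg.1 ?_) h1
  rw [key, mul_nonneg_iff_of_pos_left (by positivity)]
  have h2 : 0 ≤ (e + 2) * a * (x' - (e + 1)) :=
    mul_nonneg (by positivity) (sub_nonneg.2 hx')
  rcases le_total 0 (x' - ((e : ℝ) + k + 1)) with h3 | h3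
  · exact add_nonneg h2 (mul_nonneg (by positivity) h3)
  · refine h.trans ?_
    gcongr _ + ?_
    refine mul_le_mul_of_nonpos_right ?_ h3
    gcongr

/-- Existence of a solution of the optimality conditions, by the intermediate value theorem. The
condition `left` defines `q` as a function of `x`, the condition `ratio` then defines `X`, and
the remaining equation `right` changes sign between the values of `x` that correspond to `q₁` and
`q₂`. In the numerical hypotheses `[xL, xU]` contains these two values of `x`, `Z₁` is an upper
bound for `X` at the first, `Z₂` a lower bound for `X` at the second, and `XL` a lower bound for `X`
throughout. -/
theorem exists_optimalityConditions (ha : 0 < a) (hb : 0 < b) (hk : k ≠ 0)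
    {q₁ q₂ xL xU Z₁ Z₂ XL : ℝ} (hq₁ : 0 < q₁) (hq₁₂ : q₁ < q₂) (hq₂ : q₂ < 1) (hxL : 1 < xL)
    (hxLU : xL ≤ xU) (hZ₂ : 1 < Z₂) (hXL : 1 < XL)
    (hxL' : twoPow a b e k q₁ ≤ q₁ * twoPowDeriv a b e k q₁ * logRatio xL)
    (hxU' : q₂ * twoPowDeriv a b e k q₂ * logRatio xU ≤ twoPow a b e k q₂)
    (hZ₁x : q₁ * (twoPowDeriv a b e k 1 - twoPowDeriv a b e k q₁) ≤
      Z₁ * ((1 - q₁) * twoPowDeriv a b e k q₁ * xL))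
    (hZ₁' : twoPow a b e k 1 - twoPow a b e k q₁ ≤ (1 - q₁) * twoPowDeriv a b e k q₁ +
      (1 - q₁) * (twoPowDeriv a b e k 1 - twoPowDeriv a b e k q₁) * logRatio Z₁)
    (hZ₂x : Z₂ * ((1 - q₂) * twoPowDeriv a b e k q₂ * xU) ≤
      q₂ * (twoPowDeriv a b e k 1 - twoPowDeriv a b e k q₂))
    (hZ₂' : (1 - q₂) * twoPowDeriv a b e k q₂ +
      (1 - q₂) * (twoPowDeriv a b e k 1 - twoPowDeriv a b e k q₂) * logRatio Z₂ ≤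
        twoPow a b e k 1 - twoPow a b e k q₂)
    (hXL' : XL * ((1 - q₁) * twoPowDeriv a b e k q₂ * xU) ≤
      q₁ * (twoPowDeriv a b e k 1 - twoPowDeriv a b e k q₂))
    (hmass : (xU - 1) / q₁ < (1 - 1 / XL) / (1 - q₁))
    (hxe : (e : ℝ) + 1 ≤ xL)
    (hderiv2 : q₂ * twoPowDeriv2 a b e k q₂ ≤ xL * twoPowDeriv a b e k q₂)
    (hcurv₁ : curvature e (e + k)
      ((e + k + 2) * (e + k + 1) * b / ((e + 2) * (e + 1) * a) * q₁ ^ k) < 0)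
    (hcurv₂ : curvature e (e + k)
      ((e + k + 2) * (e + k + 1) * b / ((e + 2) * (e + 1) * a) * q₂ ^ k) < 0) :
    ∃ q x X, OptimalityConditions a b e k q x X := by
  set f := twoPowDeriv a b e k with hf
  have hq₂0 : 0 < q₂ := hq₁.trans hq₁₂
  have hxU : 1 < xU := hxL.trans_le hxLU
  -- the value of `logRatio x` for which `q` solves the condition `left`
  set T : ℝ → ℝ := fun q => (a + b * q ^ k) / ((e + 2) * a + (e + k + 2) * b * q ^ k) with hT
  have hTden : ∀ q : ℝ, 0 < q → 0 < (e + 2) * a + (e + k + 2) * b * q ^ k := fun q hq => by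
    positivity
  have hT_le : ∀ q : ℝ, 0 < q → ∀ t, T q ≤ t ↔
      a * (1 - (e + 2) * t) ≤ b * q ^ k * ((e + k + 2) * t - 1) := fun q hq t => by
    rw [hT]
    simp only
    rw [div_le_iff₀ (hTden q hq)]
    constructor <;> intro h <;> linarith
  have hle_T : ∀ q : ℝ, 0 < q → ∀ t, t ≤ T q ↔
      b * q ^ k * ((e + k + 2) * t - 1) ≤ a * (1 - (e + 2) * t) := fun q hq t => by
    rw [hT]
    simp only
    rw [le_div_iff₀ (hTden q hq)]
    constructor <;> intro h <;> linarith
  have hTlow : ∀ q : ℝ, 0 < q → 0 < (e + k + 2) * T q - 1 := fun q hq => by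
    have : (e + k + 2) * T q - 1 = k * a / ((e + 2) * a + (e + k + 2) * b * q ^ k) := by
      rw [hT]
      have := (hTden q hq).ne'
      field_simp
      ring
    rw [this]
    have := hTden q hq
    positivity
  have hT12 : T q₂ < T q₁ := by
    rw [← not_le, hT_le q₁ hq₁, not_le]
    have h1 := (hT_le q₂ hq₂0 (T q₂)).1 le_rfl
    have h2 := (hle_T q₂ hq₂0 (T q₂)).1 le_rfl
    have h3 := hTlow q₂ hq₂0
    have h4 : q₁ ^ k < q₂ ^ k := pow_lt_pow_left₀ hq₁₂ hq₁.le hk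
    calc _ < b * q₂ ^ k * ((e + k + 2) * T q₂ - 1) := by gcongr
      _ = _ := le_antisymm h2 h1
  have hψL : T q₁ ≤ logRatio xL :=
    (hT_le q₁ hq₁ _).2 ((twoPow_le_twoPowDeriv_mul_iff hq₁).1 hxL')
  have hψU : logRatio xU ≤ T q₂ :=
    (hle_T q₂ hq₂0 _).2 ((twoPowDeriv_mul_le_twoPow_iff hq₂0).1 hxU')
  have hψc : ContinuousOn logRatio (Icc xL xU) :=
    continuousOn_logRatio.mono fun x hx => hxL.trans_le hx.1
  obtain ⟨x₁, hx₁, hψ₁⟩ := intermediate_value_Icc' hxLU hψc ⟨hψU.trans hT12.le, hψL⟩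
  obtain ⟨x₂, hx₂, hψ₂⟩ := intermediate_value_Icc' hxLU hψc ⟨hψU, hT12.le.trans hψL⟩
  have hx₁₂ : x₁ ≤ x₂ := by
    by_contra! h
    have := antitoneOn_logRatio (hxL.trans_le hx₂.1) (hxL.trans_le hx₁.1) h.le
    rw [hψ₁, hψ₂] at this
    linarith
  have hI : ∀ x ∈ Icc x₁ x₂, x ∈ Icc xL xU := fun x hx =>
    ⟨hx₁.1.trans hx.1, hx.2.trans hx₂.2⟩
  have hψmem : ∀ x ∈ Icc x₁ x₂, logRatio x ∈ Icc (T q₂) (T q₁) := fun x hx => by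
    have h1 : (1 : ℝ) < x := hxL.trans_le (hI x hx).1
    rw [← hψ₁, ← hψ₂]
    exact ⟨antitoneOn_logRatio h1 (hxL.trans_le hx₂.1) hx.2,
      antitoneOn_logRatio (hxL.trans_le hx₁.1) h1 hx.1⟩
  have hden : ∀ x ∈ Icc x₁ x₂, 0 < (e + k + 2) * logRatio x - 1 := fun x hx => by
    refine (hTlow q₂ hq₂0).trans_le ?_
    gcongr
    exact (hψmem x hx).1
  set y : ℝ → ℝ := fun x => a * (1 - (e + 2) * logRatio x) / (b * ((e + k + 2) * logRatio x - 1))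
    with hy
  have hymem : ∀ x ∈ Icc x₁ x₂, y x ∈ Icc (q₁ ^ k) (q₂ ^ k) := fun x hx => by
    have h1 := (hle_T q₁ hq₁ _).1 (hψmem x hx).2
    have h2 := (hT_le q₂ hq₂0 _).1 (hψmem x hx).1
    have h3 := hden x hx
    exact ⟨(le_div_iff₀ (by positivity)).2 (by linarith),
      (div_le_iff₀ (by positivity)).2 (by linarith)⟩
  have hψI : ContinuousOn logRatio (Icc x₁ x₂) := hψc.mono hI
  have hyc : ContinuousOn y (Icc x₁ x₂) := by
    refine ContinuousOn.div (by fun_prop) (by fun_prop) fun x hx => ?_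
    have := hden x hx
    positivity
  set Q : ℝ → ℝ := fun x => y x ^ ((k : ℝ)⁻¹) with hQ
  have hy0 : ∀ x ∈ Icc x₁ x₂, 0 < y x := fun x hx => (pow_pos hq₁ k).trans_le (hymem x hx).1
  have hQk : ∀ x ∈ Icc x₁ x₂, Q x ^ k = y x := fun x hx =>
    Real.rpow_inv_natCast_pow (hy0 x hx).le hk
  have hQpos : ∀ x ∈ Icc x₁ x₂, 0 < Q x := fun x hx => Real.rpow_pos_of_pos (hy0 x hx) _
  have hQmem : ∀ x ∈ Icc x₁ x₂, Q x ∈ Icc q₁ q₂ := fun x hx => by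
    have h := hymem x hx
    rw [← hQk x hx] at h
    exact ⟨(pow_le_pow_iff_left₀ hq₁.le (hQpos x hx).le hk).1 h.1,
      (pow_le_pow_iff_left₀ (hQpos x hx).le hq₂0.le hk).1 h.2⟩
  have hQc : ContinuousOn Q (Icc x₁ x₂) := hyc.rpow_const fun x hx => Or.inl (hy0 x hx).ne'
  have hQ_eq : ∀ x ∈ Icc x₁ x₂, ∀ q, 0 < q → logRatio x = T q → Q x = q := by
    intro x hx q hq h
    have h1 := (hT_le q hq _).1 h.ge
    have h2 := (hle_T q hq _).1 h.le
    have h3 := hden x hx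
    have : y x = q ^ k := by
      rw [hy]
      simp only
      rw [div_eq_iff (by positivity)]
      linarith
    rw [← hQk x hx] at this
    exact (pow_left_inj₀ (hQpos x hx).le hq.le hk).1 this
  have hQ₁ : Q x₁ = q₁ := hQ_eq x₁ ⟨le_rfl, hx₁₂⟩ q₁ hq₁ hψ₁
  have hQ₂ : Q x₂ = q₂ := hQ_eq x₂ ⟨hx₁₂, le_rfl⟩ q₂ hq₂0 hψ₂
  have hfQ : ∀ x ∈ Icc x₁ x₂, 0 < f (Q x) := fun x hx => twoPowDeriv_pos ha hb (hQpos x hx)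
  have hfQ2 : ∀ x ∈ Icc x₁ x₂, f (Q x) ≤ f q₂ := fun x hx =>
    twoPowDeriv_mono ha hb (hQpos x hx).le (hQmem x hx).2
  have hf1 : ∀ q : ℝ, 0 < q → q < 1 → 0 < f 1 - f q := fun q h0 h1 =>
    sub_pos.2 (twoPowDeriv_lt ha hb h0.le h1)
  have hf2pos : 0 < f q₂ := twoPowDeriv_pos ha hb hq₂0
  set X : ℝ → ℝ := fun x => Q x * (f 1 - f (Q x)) / ((1 - Q x) * f (Q x) * x) with hXdef
  have hXden : ∀ x ∈ Icc x₁ x₂, 0 < (1 - Q x) * f (Q x) * x := fun x hx => by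
    have h1 : 0 < 1 - Q x := by linarith [(hQmem x hx).2]
    have h2 := hfQ x hx
    have h3 : 0 < x := by linarith [(hI x hx).1]
    positivity
  have hXge : ∀ x ∈ Icc x₁ x₂, XL ≤ X x := fun x hx => by
    rw [hXdef]
    simp only
    rw [le_div_iff₀ (hXden x hx)]
    have h1 : 0 < 1 - Q x := by linarith [(hQmem x hx).2]
    have h3 : 0 < x := by linarith [(hI x hx).1]
    have h5 := hf1 q₂ hq₂0 hq₂
    have h6 := hfQ x hx
    have h7 : 0 < 1 - q₁ := by linarith
    calc XL * ((1 - Q x) * f (Q x) * x) ≤ XL * ((1 - q₁) * f q₂ * xU) := by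
          gcongr
          · exact (hQmem x hx).1
          · exact hfQ2 x hx
          · exact (hI x hx).2
      _ ≤ q₁ * (f 1 - f q₂) := hXL'
      _ ≤ Q x * (f 1 - f (Q x)) := by
          gcongr
          · exact (hQpos x hx).le
          · exact (hQmem x hx).1
          · exact hfQ2 x hx
  have hfc : Continuous f := continuous_twoPowDeriv
  have hfQc : ContinuousOn (fun x => f (Q x)) (Icc x₁ x₂) := hfc.comp_continuousOn hQc
  have hXc : ContinuousOn X (Icc x₁ x₂) :=
    ContinuousOn.div (by fun_prop) (by fun_prop) fun x hx => (hXden x hx).ne'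
  have hψX : ContinuousOn (fun x => logRatio (X x)) (Icc x₁ x₂) :=
    continuousOn_logRatio.comp hXc fun x hx => hXL.trans_le (hXge x hx)
  have hξQ : ContinuousOn (fun x => twoPow a b e k (Q x)) (Icc x₁ x₂) :=
    continuous_twoPow.comp_continuousOn hQc
  set g : ℝ → ℝ := fun x => (1 - Q x) * f (Q x) + (1 - Q x) * (f 1 - f (Q x)) * logRatio (X x) -
    (twoPow a b e k 1 - twoPow a b e k (Q x)) with hg
  have hgc : ContinuousOn g (Icc x₁ x₂) := by fun_prop
  have hfq₁ : 0 < f q₁ := twoPowDeriv_pos ha hb hq₁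
  have h1q₁ : 0 < 1 - q₁ := by linarith
  have h1q₂ : 0 < 1 - q₂ := by linarith
  have hg₁ : 0 ≤ g x₁ := by
    have hXZ : X x₁ ≤ Z₁ := by
      have hden₁ := hXden x₁ ⟨le_rfl, hx₁₂⟩
      rw [hXdef]
      simp only
      rw [div_le_iff₀ hden₁, hQ₁]
      refine hZ₁x.trans ?_
      have hZ₁0 : 0 ≤ Z₁ := by
        by_contra! hneg
        have h1 : Z₁ * ((1 - q₁) * f q₁ * xL) < 0 := mul_neg_of_neg_of_pos hneg (by positivity)
        have h2 := mul_pos hq₁ (hf1 q₁ hq₁ (hq₁₂.trans hq₂))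
        linarith
      gcongr
      exact hx₁.1
    have hψ : logRatio Z₁ ≤ logRatio (X x₁) := by
      have h1 : 1 < X x₁ := hXL.trans_le (hXge x₁ ⟨le_rfl, hx₁₂⟩)
      exact antitoneOn_logRatio h1 (h1.trans_le hXZ) hXZ
    have h5 := hf1 q₁ hq₁ (hq₁₂.trans hq₂)
    have h6 : (1 - q₁) * (f 1 - f q₁) * logRatio Z₁ ≤
        (1 - q₁) * (f 1 - f q₁) * logRatio (X x₁) := by gcongr
    simp only [hg, hQ₁]
    linarith
  have hg₂ : g x₂ ≤ 0 := by
    have hXZ : Z₂ ≤ X x₂ := by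
      have hden₂ := hXden x₂ ⟨hx₁₂, le_rfl⟩
      rw [hXdef]
      simp only
      rw [le_div_iff₀ hden₂, hQ₂]
      refine le_trans ?_ hZ₂x
      gcongr
      exact hx₂.2
    have hψ : logRatio (X x₂) ≤ logRatio Z₂ := antitoneOn_logRatio hZ₂ (hZ₂.trans_le hXZ) hXZ
    have h5 := hf1 q₂ hq₂0 hq₂
    have h6 : (1 - q₂) * (f 1 - f q₂) * logRatio (X x₂) ≤
        (1 - q₂) * (f 1 - f q₂) * logRatio Z₂ := by gcongr
    simp only [hg, hQ₂]
    linarith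
  obtain ⟨x, hx, hgx⟩ := intermediate_value_Icc' hx₁₂ hgc ⟨hg₂, hg₁⟩
  have hq := hQmem x hx
  have hq0 := hQpos x hx
  have hxI := hI x hx
  have h1q : 0 < 1 - Q x := by linarith [hq.2]
  refine ⟨Q x, x, X x, ⟨hq0, hq.2.trans_lt hq₂⟩, hxL.trans_le hxI.1, hXL.trans_le (hXge x hx),
    ?_, ?_, ?_, ?_, ?_, ?_⟩
  · exact div_mul_cancel₀ _ (hXden x hx).ne'
  · have h3 := hden x hx
    have hyx : b * Q x ^ k * ((e + k + 2) * logRatio x - 1) = a * (1 - (e + 2) * logRatio x) := by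
      rw [hQk x hx, hy]
      simp only
      rw [mul_comm b, mul_assoc, div_mul_cancel₀ _ (by positivity)]
    exact le_antisymm ((twoPow_le_twoPowDeriv_mul_iff hq0).2 hyx.ge)
      ((twoPowDeriv_mul_le_twoPow_iff hq0).2 hyx.le)
  · simp only [hg] at hgx
    linarith
  · exact deriv2_le_of_le ha hq0 hq.2 hb hxe hxI.1 hderiv2
  · refine curvature_neg_of_between (by positivity) hcurv₁ hcurv₂ ⟨?_, ?_⟩
    · gcongr
      exact hq.1
    · gcongr
      exact hq.2
  · have hX0 : 0 < XL := by linarith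
    calc (x - 1) / Q x ≤ (xU - 1) / q₁ := by
          gcongr
          · exact hxI.2
          · exact hq.1
      _ < (1 - 1 / XL) / (1 - q₁) := hmass
      _ ≤ (1 - 1 / X x) / (1 - Q x) := by
          have h7 : 1 / X x ≤ 1 / XL := one_div_le_one_div_of_le hX0 (hXge x hx)
          have h8 : 1 / XL < 1 := by
            rw [div_lt_one hX0]
            exact hXL
          gcongr
          · linarith
          · exact hq.1

end

/-! ### Logarithm bounds, mixtures of two powers, and numerical data -/

theorem le_log_of_le_sum {r c : ℝ} (hr : 1 ≤ r) (n : ℕ)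
    (h : c ≤ 2 * ∑ i ∈ Finset.range n, ((r - 1) / (r + 1)) ^ (2 * i + 1) / (2 * i + 1)) :
    c ≤ Real.log r := by
  have h1 := Real.sum_range_le_log_div (x := (r - 1) / (r + 1))
    (div_nonneg (by linarith) (by linarith)) ((div_lt_one (by linarith)).2 (by linarith)) n
  have h2 : (1 + (r - 1) / (r + 1)) / (1 - (r - 1) / (r + 1)) = r := by
    have : r + 1 ≠ 0 := by linarith
    field_simp
    ring
  rw [h2] at h1
  linarith

theorem log_le_of_sum_le {r c : ℝ} (hr : 1 ≤ r) (n : ℕ)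
    (h : 2 * ((∑ i ∈ Finset.range n, ((r - 1) / (r + 1)) ^ (2 * i + 1) / (2 * i + 1)) +
      ((r - 1) / (r + 1)) ^ (2 * n + 1) / (1 - ((r - 1) / (r + 1)) ^ 2)) ≤ c) :
    Real.log r ≤ c := by
  have h1 := Real.log_div_le_sum_range_add (x := (r - 1) / (r + 1))
    (div_nonneg (by linarith) (by linarith)) ((div_lt_one (by linarith)).2 (by linarith)) n
  have h2 : (1 + (r - 1) / (r + 1)) / (1 - (r - 1) / (r + 1)) = r := by
    have : r + 1 ≠ 0 := by linarith
    field_simp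
    ring
  rw [h2] at h1
  linarith

theorem le_mul_logRatio {u v c x l : ℝ} (hc : 0 ≤ c) (hx : 1 < x) (hl : l ≤ Real.log x)
    (h : u ≤ v + c * ((x * l - x + 1) / (x - 1) ^ 2)) : u ≤ v + c * logRatio x := by
  refine h.trans ?_
  unfold logRatio
  gcongr

theorem mul_logRatio_le {u v c x l : ℝ} (hc : 0 ≤ c) (hx : 1 < x) (hl : Real.log x ≤ l)
    (h : v + c * ((x * l - x + 1) / (x - 1) ^ 2) ≤ u) : v + c * logRatio x ≤ u := by
  refine le_trans ?_ h
  unfold logRatio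
  gcongr

theorem le_mul_logRatio₀ {u c x l : ℝ} (hc : 0 ≤ c) (hx : 1 < x) (hl : l ≤ Real.log x)
    (h : u ≤ c * ((x * l - x + 1) / (x - 1) ^ 2)) : u ≤ c * logRatio x := by
  simpa using le_mul_logRatio (v := 0) hc hx hl (by simpa using h)

theorem mul_logRatio_le₀ {u c x l : ℝ} (hc : 0 ≤ c) (hx : 1 < x) (hl : Real.log x ≤ l)
    (h : c * ((x * l - x + 1) / (x - 1) ^ 2) ≤ u) : c * logRatio x ≤ u := by
  simpa using mul_logRatio_le (v := 0) hc hx hl (by simpa using h)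

/-- The mixture `a x ^ (e + 2) + b x ^ (e + k + 2)`. -/
noncomputable def twoPowMixture (a b : ℝ) (e k : ℕ) (ha : 0 ≤ a) (hb : 0 ≤ b) (hab : a + b = 1)
    (hk : k ≠ 0) : Mixture where
  c p := if p = e + 2 then √a else if p = e + k + 2 then √b else 0
  c_nonneg p := by split_ifs <;> positivity
  c_zero := by simp
  c_one := by simp
  hasSum_sq := by
    have h : HasSum (fun p => (if p = e + 2 then √a else if p = e + k + 2 then √b else 0) ^ 2)
        (∑ p ∈ {e + 2, e + k + 2},
          (if p = e + 2 then √a else if p = e + k + 2 then √b else 0) ^ 2) := by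
      refine hasSum_sum_of_ne_finset_zero fun p hp => ?_
      simp only [Finset.mem_insert, Finset.mem_singleton, not_or] at hp
      simp [hp]
    rw [Finset.sum_pair (by omega)] at h
    simpa [hk, Real.sq_sqrt ha, Real.sq_sqrt hb, hab] using h
  summable_two_pow_mul := by
    refine summable_of_ne_finset_zero (s := {e + 2, e + k + 2}) ?_
    intro p hp
    simp only [Finset.mem_insert, Finset.mem_singleton, not_or] at hp
    simp [hp]

section

variable {a b : ℝ} {e k : ℕ} (ha : 0 ≤ a) (hb : 0 ≤ b) (hab : a + b = 1) (hk : k ≠ 0)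

theorem twoPowMixture_eval (x : ℝ) :
    (twoPowMixture a b e k ha hb hab hk).eval x = twoPow a b e k x := by
  rw [Mixture.eval, tsum_eq_sum (s := {e + 2, e + k + 2}), Finset.sum_pair (by omega)]
  · simp [twoPowMixture, hk, Real.sq_sqrt ha, Real.sq_sqrt hb, twoPow]
  · intro p hp
    simp only [Finset.mem_insert, Finset.mem_singleton, not_or] at hp
    simp [twoPowMixture, hp]

theorem twoPowMixture_c_two (he : e ≠ 0) : (twoPowMixture a b e k ha hb hab hk).c 2 = 0 := by
  simp [twoPowMixture, he]

theorem twoPowMixture_G :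
    (twoPowMixture a b e k ha hb hab hk).G =
      Real.log (twoPowDeriv2 a b e k 1 / twoPowDeriv a b e k 1) -
        (twoPowDeriv2 a b e k 1 - twoPowDeriv a b e k 1) *
          (twoPowDeriv2 a b e k 1 - twoPowDeriv a b e k 1 + twoPowDeriv a b e k 1 ^ 2) /
          (twoPowDeriv2 a b e k 1 * twoPowDeriv a b e k 1 ^ 2) := by
  have h1 : deriv (twoPowMixture a b e k ha hb hab hk).eval = twoPowDeriv a b e k := by
    rw [funext (twoPowMixture_eval ha hb hab hk)]
    exact funext fun s => (hasDerivAt_twoPow s).deriv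
  have h2 : deriv (twoPowDeriv a b e k) = twoPowDeriv2 a b e k :=
    funext fun s => (hasDerivAt_twoPowDeriv s).deriv
  rw [Mixture.G, h1, h2]

end


theorem exists_optimalityConditions_five_sevenths_three_sixteen :
    ∃ q x X, OptimalityConditions (5 / 7) (2 / 7) 1 13 q x X := by
  have l₁ : (1.0986 : ℝ) ≤ Real.log 3 :=
    le_log_of_le_sum (by norm_num) 7 (by norm_num [Finset.sum_range_succ])
  have l₂ : Real.log 3.1 ≤ (1.1315 : ℝ) :=
    log_le_of_sum_le (by norm_num) 8 (by norm_num [Finset.sum_range_succ])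
  have l₃ : (1.4516 : ℝ) ≤ Real.log 4.27 :=
    le_log_of_le_sum (by norm_num) 10 (by norm_num [Finset.sum_range_succ])
  have l₄ : Real.log 4.15 ≤ (1.4232 : ℝ) :=
    log_le_of_sum_le (by norm_num) 11 (by norm_num [Finset.sum_range_succ])
  refine exists_optimalityConditions (a := 5 / 7) (b := 2 / 7) (e := 1) (k := 13)
    (q₁ := 0.74) (q₂ := 0.75) (xL := 3) (xU := 3.1) (Z₁ := 4.27) (Z₂ := 4.15) (XL := 3.9)
    (by norm_num) (by norm_num) (by norm_num) (by norm_num) (by norm_num) (by norm_num)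
    (by norm_num) (by norm_num) (by norm_num) (by norm_num) ?_ ?_ ?_ ?_ ?_ ?_ ?_ ?_
    (by norm_num) ?_ ?_ ?_
  · exact le_mul_logRatio₀ (by norm_num [twoPowDeriv]) (by norm_num) l₁
      (by norm_num [twoPow, twoPowDeriv])
  · exact mul_logRatio_le₀ (by norm_num [twoPowDeriv]) (by norm_num) l₂
      (by norm_num [twoPow, twoPowDeriv])
  · norm_num [twoPowDeriv]
  · exact le_mul_logRatio (by norm_num [twoPowDeriv]) (by norm_num) l₃
      (by norm_num [twoPow, twoPowDeriv])
  · norm_num [twoPowDeriv]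
  · exact mul_logRatio_le (by norm_num [twoPowDeriv]) (by norm_num) l₄
      (by norm_num [twoPow, twoPowDeriv])
  · norm_num [twoPowDeriv]
  · norm_num
  · norm_num [twoPowDeriv, twoPowDeriv2]
  · norm_num [curvature]
  · norm_num [curvature]

theorem exists_optimalityConditions_five_sixths_three_sixteen :
    ∃ q x X, OptimalityConditions (5 / 6) (1 / 6) 1 13 q x X := by
  have l₁ : (1.1631 : ℝ) ≤ Real.log 3.2 :=
    le_log_of_le_sum (by norm_num) 6 (by norm_num [Finset.sum_range_succ])
  have l₂ : Real.log 3.32 ≤ (1.2 : ℝ) :=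
    log_le_of_sum_le (by norm_num) 9 (by norm_num [Finset.sum_range_succ])
  have l₃ : (0.9669 : ℝ) ≤ Real.log 2.63 :=
    le_log_of_le_sum (by norm_num) 5 (by norm_num [Finset.sum_range_succ])
  have l₄ : Real.log 2.55 ≤ (0.9361 : ℝ) :=
    log_le_of_sum_le (by norm_num) 8 (by norm_num [Finset.sum_range_succ])
  refine exists_optimalityConditions (a := 5 / 6) (b := 1 / 6) (e := 1) (k := 13)
    (q₁ := 0.82) (q₂ := 0.83) (xL := 3.2) (xU := 3.32) (Z₁ := 2.63) (Z₂ := 2.55) (XL := 2.3)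
    (by norm_num) (by norm_num) (by norm_num) (by norm_num) (by norm_num) (by norm_num)
    (by norm_num) (by norm_num) (by norm_num) (by norm_num) ?_ ?_ ?_ ?_ ?_ ?_ ?_ ?_
    (by norm_num) ?_ ?_ ?_
  · exact le_mul_logRatio₀ (by norm_num [twoPowDeriv]) (by norm_num) l₁
      (by norm_num [twoPow, twoPowDeriv])
  · exact mul_logRatio_le₀ (by norm_num [twoPowDeriv]) (by norm_num) l₂
      (by norm_num [twoPow, twoPowDeriv])
  · norm_num [twoPowDeriv]
  · exact le_mul_logRatio (by norm_num [twoPowDeriv]) (by norm_num) l₃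
      (by norm_num [twoPow, twoPowDeriv])
  · norm_num [twoPowDeriv]
  · exact mul_logRatio_le (by norm_num [twoPowDeriv]) (by norm_num) l₄
      (by norm_num [twoPow, twoPowDeriv])
  · norm_num [twoPowDeriv]
  · norm_num
  · norm_num [twoPowDeriv, twoPowDeriv2]
  · norm_num [curvature]
  · norm_num [curvature]

theorem exists_optimalityConditions_five_sixths_four_forty :
    ∃ q x X, OptimalityConditions (5 / 6) (1 / 6) 2 36 q x X := by
  have l₁ : (1.6486 : ℝ) ≤ Real.log 5.2 :=
    le_log_of_le_sum (by norm_num) 10 (by norm_num [Finset.sum_range_succ])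
  have l₂ : Real.log 5.6 ≤ (1.7228 : ℝ) :=
    log_le_of_sum_le (by norm_num) 16 (by norm_num [Finset.sum_range_succ])
  have l₃ : (1.5892 : ℝ) ≤ Real.log 4.9 :=
    le_log_of_le_sum (by norm_num) 10 (by norm_num [Finset.sum_range_succ])
  have l₄ : Real.log 4.7 ≤ (1.5476 : ℝ) :=
    log_le_of_sum_le (by norm_num) 13 (by norm_num [Finset.sum_range_succ])
  refine exists_optimalityConditions (a := 5 / 6) (b := 1 / 6) (e := 2) (k := 36)
    (q₁ := 0.89) (q₂ := 0.90) (xL := 5.2) (xU := 5.6) (Z₁ := 4.9) (Z₂ := 4.7) (XL := 4.2)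
    (by norm_num) (by norm_num) (by norm_num) (by norm_num) (by norm_num) (by norm_num)
    (by norm_num) (by norm_num) (by norm_num) (by norm_num) ?_ ?_ ?_ ?_ ?_ ?_ ?_ ?_
    (by norm_num) ?_ ?_ ?_
  · exact le_mul_logRatio₀ (by norm_num [twoPowDeriv]) (by norm_num) l₁
      (by norm_num [twoPow, twoPowDeriv])
  · exact mul_logRatio_le₀ (by norm_num [twoPowDeriv]) (by norm_num) l₂
      (by norm_num [twoPow, twoPowDeriv])
  · norm_num [twoPowDeriv]
  · exact le_mul_logRatio (by norm_num [twoPowDeriv]) (by norm_num) l₃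
      (by norm_num [twoPow, twoPowDeriv])
  · norm_num [twoPowDeriv]
  · exact mul_logRatio_le (by norm_num [twoPowDeriv]) (by norm_num) l₄
      (by norm_num [twoPow, twoPowDeriv])
  · norm_num [twoPowDeriv]
  · norm_num
  · norm_num [twoPowDeriv, twoPowDeriv2]
  · norm_num [curvature]
  · norm_num [curvature]

theorem exists_optimalityConditions_five_eighths_four_forty :
    ∃ q x X, OptimalityConditions (5 / 8) (3 / 8) 2 36 q x X := by
  have l₁ : (1.6438 : ℝ) ≤ Real.log 5.175 :=
    le_log_of_le_sum (by norm_num) 11 (by norm_num [Finset.sum_range_succ])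
  have l₂ : Real.log 5.2 ≤ (1.6487 : ℝ) :=
    log_le_of_sum_le (by norm_num) 15 (by norm_num [Finset.sum_range_succ])
  have l₃ : (2.3542 : ℝ) ≤ Real.log 10.53 :=
    le_log_of_le_sum (by norm_num) 22 (by norm_num [Finset.sum_range_succ])
  have l₄ : Real.log 10.5 ≤ (2.352 : ℝ) :=
    log_le_of_sum_le (by norm_num) 24 (by norm_num [Finset.sum_range_succ])
  refine exists_optimalityConditions (a := 5 / 8) (b := 3 / 8) (e := 2) (k := 36)
    (q₁ := 0.83) (q₂ := 0.831) (xL := 5.175) (xU := 5.2) (Z₁ := 10.53) (Z₂ := 10.5) (XL := 10.4)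
    (by norm_num) (by norm_num) (by norm_num) (by norm_num) (by norm_num) (by norm_num)
    (by norm_num) (by norm_num) (by norm_num) (by norm_num) ?_ ?_ ?_ ?_ ?_ ?_ ?_ ?_
    (by norm_num) ?_ ?_ ?_
  · exact le_mul_logRatio₀ (by norm_num [twoPowDeriv]) (by norm_num) l₁
      (by norm_num [twoPow, twoPowDeriv])
  · exact mul_logRatio_le₀ (by norm_num [twoPowDeriv]) (by norm_num) l₂
      (by norm_num [twoPow, twoPowDeriv])
  · norm_num [twoPowDeriv]
  · exact le_mul_logRatio (by norm_num [twoPowDeriv]) (by norm_num) l₃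
      (by norm_num [twoPow, twoPowDeriv])
  · norm_num [twoPowDeriv]
  · exact mul_logRatio_le (by norm_num [twoPowDeriv]) (by norm_num) l₄
      (by norm_num [twoPow, twoPowDeriv])
  · norm_num [twoPowDeriv]
  · norm_num
  · norm_num [twoPowDeriv, twoPowDeriv2]
  · norm_num [curvature]
  · norm_num [curvature]

/-! ### The four mixtures -/

theorem theorem1 :
    (∃ ξ : Mixture, (∀ x : ℝ, ξ.eval x = 5 / 7 * x ^ 3 + 2 / 7 * x ^ 16) ∧
      ξ.PureLike ∧ ξ.HasThreeAtoms) ∧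
    (∃ ξ : Mixture, (∀ x : ℝ, ξ.eval x = 5 / 6 * x ^ 3 + 1 / 6 * x ^ 16) ∧
      ξ.FullMixture ∧ ξ.HasThreeAtoms) ∧
    (∃ ξ : Mixture, (∀ x : ℝ, ξ.eval x = 5 / 6 * x ^ 4 + 1 / 6 * x ^ 40) ∧
      ξ.FullMixture ∧ ξ.HasThreeAtoms) ∧
    (∃ ξ : Mixture, (∀ x : ℝ, ξ.eval x = 5 / 8 * x ^ 4 + 3 / 8 * x ^ 40) ∧
      ξ.PureLike ∧ ξ.HasThreeAtoms) ∧
    ¬ (∀ ξ : Mixture, ξ.c 2 = 0 → (ξ.IsRSB 1 ↔ ξ.PureLike)) := by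
  obtain ⟨q₁, x₁, X₁, H₁⟩ := exists_optimalityConditions_five_sevenths_three_sixteen
  obtain ⟨q₂, x₂, X₂, H₂⟩ := exists_optimalityConditions_five_sixths_three_sixteen
  obtain ⟨q₃, x₃, X₃, H₃⟩ := exists_optimalityConditions_five_sixths_four_forty
  obtain ⟨q₄, x₄, X₄, H₄⟩ := exists_optimalityConditions_five_eighths_four_forty
  set ξ₁ := twoPowMixture (5 / 7) (2 / 7) 1 13 (by norm_num) (by norm_num) (by norm_num)
    (by norm_num) with hξ₁
  have h₁ : ξ₁.HasThreeAtoms := H₁.hasThreeAtoms (by norm_num) (by norm_num) (by norm_num)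
    (by norm_num) (twoPowMixture_eval _ _ _ _)
  have hG₁ : ξ₁.PureLike := by
    have hl : (2.38 : ℝ) ≤ Real.log (510 / 47) :=
      le_log_of_le_sum (by norm_num) 14 (by norm_num [Finset.sum_range_succ])
    rw [Mixture.PureLike, hξ₁, twoPowMixture_G]
    norm_num [twoPowDeriv, twoPowDeriv2]
    linarith
  refine ⟨⟨ξ₁, fun x => ?_, hG₁, h₁⟩,
    ⟨twoPowMixture (5 / 6) (1 / 6) 1 13 (by norm_num) (by norm_num) (by norm_num) (by norm_num),
      fun x => ?_, ?_, H₂.hasThreeAtoms (by norm_num) (by norm_num) (by norm_num) (by norm_num)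
        (twoPowMixture_eval _ _ _ _)⟩,
    ⟨twoPowMixture (5 / 6) (1 / 6) 2 36 (by norm_num) (by norm_num) (by norm_num) (by norm_num),
      fun x => ?_, ?_, H₃.hasThreeAtoms (by norm_num) (by norm_num) (by norm_num) (by norm_num)
        (twoPowMixture_eval _ _ _ _)⟩,
    ⟨twoPowMixture (5 / 8) (3 / 8) 2 36 (by norm_num) (by norm_num) (by norm_num) (by norm_num),
      fun x => ?_, ?_, H₄.hasThreeAtoms (by norm_num) (by norm_num) (by norm_num) (by norm_num)
        (twoPowMixture_eval _ _ _ _)⟩, fun h => h₁.not_isRSB_one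
          ((h ξ₁ (twoPowMixture_c_two _ _ _ _ one_ne_zero)).2 hG₁)⟩
  · rw [twoPowMixture_eval, twoPow]
  · rw [twoPowMixture_eval, twoPow]
  · have hl : Real.log (270 / 31) ≤ (2.18 : ℝ) :=
      log_le_of_sum_le (by norm_num) 14 (by norm_num [Finset.sum_range_succ])
    rw [Mixture.FullMixture, twoPowMixture_G]
    norm_num [twoPowDeriv, twoPowDeriv2]
    linarith
  · rw [twoPowMixture_eval, twoPow]
  · have hl : Real.log 27 ≤ (3.3 : ℝ) := by
      have h3 : Real.log 3 ≤ (1.1 : ℝ) :=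
        log_le_of_sum_le (by norm_num) 8 (by norm_num [Finset.sum_range_succ])
      rw [show (27 : ℝ) = 3 ^ 3 by norm_num, Real.log_pow]
      norm_num at h3 ⊢
      linarith
    rw [Mixture.FullMixture, twoPowMixture_G]
    norm_num [twoPowDeriv, twoPowDeriv2]
    linarith
  · rw [twoPowMixture_eval, twoPow]
  · have hl : (3 : ℝ) ≤ Real.log (237 / 7) :=
      le_log_of_le_sum (by norm_num) 16 (by norm_num [Finset.sum_range_succ])
    rw [Mixture.PureLike, twoPowMixture_G]
    norm_num [twoPowDeriv, twoPowDeriv2]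
    linarith
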